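/- Let $F$ be a non-archimedean local field (for instance a $p$-adic field) with ring of integers $\mathcal O$, maximal ideal $\mathfrak p=\varpi\mathcal O$ and residue field of cardinality $q$, and normalize the absolute value by $|\varpi|=q^{-1}$. Let $\psi$ be a non-trivial continuous (unitary) character of $F$, let $d_\psi x$ be the self-dual Haar measure on $F$ with respect to $\psi$, and put $d_\psi^*x=|x|^{-1}d_\psi x$ on $F^*$. Let $S(F)$ be the space of locally constant compactly supported functions $\phi:F\to\mathbb C$, and for $\phi\in S(F)$ let $\widehat\phi(x)=\int_F\phi(y)\psi(xy)\,d_\psi y$. Let $\chi:F^*\to\mathbb C^*$ be a continuous character (not necessarily unitary), called unramified if it is trivial on $\mathcal O^*$ and ramified otherwise. Let $e(\psi)$ be the least integer $e$ such that $\psi$ is trivial on $\mathfrak p^e$, let $e(\chi)$ be the least integer $e\ge 0$ such that $\chi$ is trivial on $\mathcal O^*\cap(1+\mathfrak p^e)$, and put $e(\psi,\chi)=e(\psi)-e(\chi)$. For a function $f$ on $F^*$ let $\zeta(s,\chi,f)$ be the meromorphic continuation in $s\in\mathbb C$ of $\int_{F^*}f(x)|x|^s\chi(x)\,d_\psi^*x$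 (from a right half-plane of absolute convergence). Put $L(s,\chi)=(1-\chi(\varpi)q^{-s})^{-1}$ if $\chi$ is unramified and $L(s,\chi)=1$ if $\chi$ is ramified. The Tate factor $\gamma(s,\chi,\psi)$ is the meromorphic function with $\zeta(1-s,\chi^{-1},\widehat\phi)=\gamma(s,\chi,\psi)\,\zeta(s,\chi,\phi)$ for all $\phi\in S(F)$, and $\epsilon(s,\chi,\psi)$ is defined by $\gamma(s,\chi,\psi)=\epsilon(s,\chi,\psi)\,L(1-s,\chi^{-1})/L(s,\chi)$. Let $n\ge 1$. For $k\in\mathbb Z$ let $\beta_{n,k}$ be the characteristic function of $F^*_{n,k}=\{u\varpi^m: u\in\mathcal O^*,\ m\in k+n\mathbb Z\}$, and for $\phi\in S(F)$ put $\zeta_{n,k}(s,\chi,\phi)=\zeta(s,\chi,\phi\cdot\beta_{n,k})$. **Theorem.** For every integer $k$ with $0\le k<n$ and every $\phi\in S(F)$, the partial Mellin transforms below have meromorphic continuations to $\mathbb C$, and, as meromorphic functions of $s$, $$\zeta_{n,k}(s,\chi,\widehat\phi)=\sum_{m=0}^{n-1}\theta_m(s,\chi,\psi)\,\zeta_{n,\,m+e(\psi,\chi)-k}(1-s,\chi^{-1},\phi),$$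 where, for unramified $\chi$, $$\theta_m(s,\chi,\psi)=\epsilon(s,\chi,\psi)^{-1}L(ns,\chi^n)\bigl(\chi(\varpi)q^{-s}\bigr)^m\times\begin{cases}1-q^{-1}, & 0\le m\le n-2,\\ L(1-ns,\chi^{-n})^{-1}, & m=n-1,\end{cases}$$ and, for ramified $\chi$, $$\theta_m(s,\chi,\psi)=\begin{cases}\chi(-1)\,\epsilon(s,\chi,\psi)^{-1}, & m=0,\\ 0, & m\ne 0.\end{cases}$$ -/

import Mathlib

open MeasureTheory Filter

/-! Throughout, a non-archimedean local field is a locally compact (`ProperSpace`), non-discrete,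
ultrametric normed field `F`; its norm is normalized by a hypothesis of the theorem.
A quasi-character of `F^*` is a continuous homomorphism `Fˣ →ₜ* ℂˣ`. -/

noncomputable section

namespace LocalTate

/-- The cardinality `q` of the residue field of `F` (the residue field of the closed unit ball). -/
def residueCard (F : Type*) [NontriviallyNormedField F] [IsUltrametricDist F] : ℕ :=
  Nat.card (IsLocalRing.ResidueField (NormedField.valuation (K := F)).valuationSubring)

/-- `ϖ` generates the maximal ideal `{x | ‖x‖ < 1}` of the ring of integers `{x | ‖x‖ ≤ 1}`. -/
def IsUniformizer {F : Type*} [NontriviallyNormedField F] (ϖ : Fˣ) : Prop :=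
  ‖(ϖ : F)‖ < 1 ∧ ∀ x : F, ‖x‖ < 1 → ‖x‖ ≤ ‖(ϖ : F)‖

/-- Schwartz(-Bruhat) functions on `F`. -/
def IsSchwartzBruhat {F : Type*} [NontriviallyNormedField F] (φ : F → ℂ) : Prop :=
  IsLocallyConstant φ ∧ HasCompactSupport φ

/-- The `ψ`-Fourier transform with respect to the measure `μ`. -/
def fourierWith {F : Type*} [NontriviallyNormedField F] [MeasurableSpace F]
    (ψ : AddChar F Circle) (μ : Measure F) (φ : F → ℂ) (x : F) : ℂ :=
  ∫ y, φ y * (ψ (x * y) : ℂ) ∂μ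

/-- `μ` is a Haar measure on `F` for which Fourier inversion with respect to `ψ` holds. -/
def IsSelfDual {F : Type*} [NontriviallyNormedField F] [MeasurableSpace F]
    (ψ : AddChar F Circle) (μ : Measure F) : Prop :=
  μ.IsAddHaarMeasure ∧ ∀ φ : F → ℂ, IsSchwartzBruhat φ →
    ∀ x, fourierWith ψ μ (fourierWith ψ μ φ) x = φ (-x)

open Classical in
/-- The self-dual Haar measure `d_ψ x` (it exists and is unique for continuous `ψ ≠ 1`). -/
def selfDualMeasure {F : Type*} [NontriviallyNormedField F] [MeasurableSpace F]
    (ψ : AddChar F Circle) : Measure F :=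
  if h : ∃ μ : Measure F, IsSelfDual ψ μ then h.choose else 0

/-- The Fourier transform `φ ↦ φ̂`, `φ̂(x) = ∫ φ(y) ψ(xy) d_ψ y`. -/
def fourier {F : Type*} [NontriviallyNormedField F] [MeasurableSpace F]
    (ψ : AddChar F Circle) (φ : F → ℂ) : F → ℂ :=
  fourierWith ψ (selfDualMeasure ψ) φ

/-- The Haar measure `d_ψ^* x = |x|⁻¹ d_ψ x` on `F^*`. -/
def mulMeasure {F : Type*} [NontriviallyNormedField F] [MeasurableSpace F]
    (ψ : AddChar F Circle) : Measure Fˣ :=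
  ((selfDualMeasure ψ).comap (Units.val : Fˣ → F)).withDensity
    (fun x => ENNReal.ofReal ‖(x : F)‖⁻¹)

/-- The integrand `f(x) |x|^s χ(x)` of the Mellin transform of a function `f` on `F^*`. -/
def mellinIntegrand {F : Type*} [NontriviallyNormedField F]
    (χ : Fˣ →ₜ* ℂˣ) (f : Fˣ → ℂ) (s : ℂ) (x : Fˣ) : ℂ :=
  f x * ((‖(x : F)‖ : ℝ) : ℂ) ^ s * ((χ x : ℂˣ) : ℂ)

/-- `Z` is the meromorphic continuation to `ℂ` of the Mellin integral
`∫ f(x) |x|^s χ(x) d_ψ^* x`: the integral converges absolutely on some right half-plane and equals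
`Z` there, and `Z` is meromorphic. The normal form fixes the values of `Z` at the exceptional
points (`0` at a pole, the limit at a removable singularity), so that `Z` is unique. -/
def IsMellinContinuation {F : Type*} [NontriviallyNormedField F] [MeasurableSpace F]
    (ψ : AddChar F Circle) (χ : Fˣ →ₜ* ℂˣ) (f : Fˣ → ℂ) (Z : ℂ → ℂ) : Prop :=
  MeromorphicNFOn Z Set.univ ∧ ∃ a : ℝ, ∀ s : ℂ, a < s.re →
    Integrable (mellinIntegrand χ f s) (mulMeasure ψ) ∧
      Z s = ∫ x, mellinIntegrand χ f s x ∂(mulMeasure ψ)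

open Classical in
/-- The Mellin transform `ζ(s, χ, f)` (with respect to `d_ψ^* x`) of a function `f` on `F^*`. -/
def zeta {F : Type*} [NontriviallyNormedField F] [MeasurableSpace F]
    (ψ : AddChar F Circle) (s : ℂ) (χ : Fˣ →ₜ* ℂˣ) (f : Fˣ → ℂ) : ℂ :=
  if h : ∃ Z : ℂ → ℂ, IsMellinContinuation ψ χ f Z then h.choose s else 0

/-- `χ` is trivial on the units of the ring of integers. -/
def IsUnramified {F : Type*} [NontriviallyNormedField F] (χ : Fˣ →ₜ* ℂˣ) : Prop :=
  ∀ u : Fˣ, ‖(u : F)‖ = 1 → χ u = 1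

/-- `e(ψ)`: the least integer `e` such that `ψ` is trivial on `𝔭^e = ϖ^e 𝒪`. -/
def addConductor {F : Type*} [NontriviallyNormedField F] (ϖ : Fˣ) (ψ : AddChar F Circle) : ℤ :=
  sInf {e : ℤ | ∀ x : F, ‖x‖ ≤ ‖(ϖ : F)‖ ^ e → ψ x = 1}

/-- `e(χ)`: the least `e ≥ 0` such that `χ` is trivial on `𝒪^* ∩ (1 + 𝔭^e)`
(which is `𝒪^*` for `e = 0`). -/
def mulConductor {F : Type*} [NontriviallyNormedField F] (ϖ : Fˣ) (χ : Fˣ →ₜ* ℂˣ) : ℕ :=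
  sInf {e : ℕ | ∀ u : Fˣ, ‖(u : F)‖ = 1 → ‖(u : F) - 1‖ ≤ ‖(ϖ : F)‖ ^ e → χ u = 1}

/-- `e(ψ, χ) = e(ψ) - e(χ)`. -/
def relConductor {F : Type*} [NontriviallyNormedField F] (ϖ : Fˣ) (ψ : AddChar F Circle)
    (χ : Fˣ →ₜ* ℂˣ) : ℤ :=
  addConductor ϖ ψ - (mulConductor ϖ χ : ℤ)

open Classical in
/-- The local `L`-factor: `(1 - χ(ϖ) q^{-s})⁻¹` for unramified `χ`, and `1` for ramified `χ`. -/
def LFactor {F : Type*} [NontriviallyNormedField F] [IsUltrametricDist F] (ϖ : Fˣ)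
    (s : ℂ) (χ : Fˣ →ₜ* ℂˣ) : ℂ :=
  if IsUnramified χ then (1 - ((χ ϖ : ℂˣ) : ℂ) * (residueCard F : ℂ) ^ (-s))⁻¹ else 1

/-- `g` is the meromorphic function satisfying
`ζ(1 - s, χ⁻¹, φ̂) = g(s) ζ(s, χ, φ)` for all Schwartz functions `φ`, as an identity of meromorphic
functions of `s`. -/
def IsTateGamma {F : Type*} [NontriviallyNormedField F] [MeasurableSpace F]
    (ψ : AddChar F Circle) (χ : Fˣ →ₜ* ℂˣ) (g : ℂ → ℂ) : Prop :=
  MeromorphicNFOn g Set.univ ∧ ∀ φ : F → ℂ, IsSchwartzBruhat φ →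
    (fun s : ℂ => zeta ψ (1 - s) χ⁻¹ (fun x => fourier ψ φ x))
      =ᶠ[codiscrete ℂ] fun s : ℂ => g s * zeta ψ s χ (fun x => φ x)

open Classical in
/-- The Tate gamma factor `γ(s, χ, ψ)`. -/
def tateGamma {F : Type*} [NontriviallyNormedField F] [MeasurableSpace F]
    (s : ℂ) (χ : Fˣ →ₜ* ℂˣ) (ψ : AddChar F Circle) : ℂ :=
  if h : ∃ g : ℂ → ℂ, IsTateGamma ψ χ g then h.choose s else 0

/-- The `ε`-factor, defined by `γ(s, χ, ψ) = ε(s, χ, ψ) L(1 - s, χ⁻¹) / L(s, χ)` as an identity of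
meromorphic functions (the normal form fills in the removable singularities of the quotient). -/
def epsilon {F : Type*} [NontriviallyNormedField F] [IsUltrametricDist F] [MeasurableSpace F]
    (ϖ : Fˣ) (s : ℂ) (χ : Fˣ →ₜ* ℂˣ) (ψ : AddChar F Circle) : ℂ :=
  toMeromorphicNFOn
    (fun z : ℂ => tateGamma z χ ψ * LFactor ϖ z χ / LFactor ϖ (1 - z) χ⁻¹) Set.univ s

/-- `F^*_{n,k}`: the elements `u ϖ^m` with `u` a unit of the ring of integers and `m ∈ k + nℤ`. -/
def valuationClass {F : Type*} [NontriviallyNormedField F] (ϖ : Fˣ) (n : ℕ) (k : ℤ) : Set Fˣ :=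
  {x | ∃ (u : Fˣ) (m : ℤ), ‖(u : F)‖ = 1 ∧ m ≡ k [ZMOD n] ∧ x = u * ϖ ^ m}

/-- `φ · β_{n,k}` on `F^*`, where `β_{n,k}` is the characteristic function of `F^*_{n,k}`. -/
def cutoff {F : Type*} [NontriviallyNormedField F] (ϖ : Fˣ) (n : ℕ) (k : ℤ) (φ : F → ℂ) :
    Fˣ → ℂ :=
  (valuationClass ϖ n k).indicator (fun x => φ x)

/-- The partial Mellin transform `ζ_{n,k}(s, χ, φ) = ζ(s, χ, φ · β_{n,k})`. -/
def partialZeta {F : Type*} [NontriviallyNormedField F] [MeasurableSpace F]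
    (ϖ : Fˣ) (ψ : AddChar F Circle) (n : ℕ) (k : ℤ) (s : ℂ) (χ : Fˣ →ₜ* ℂˣ) (φ : F → ℂ) : ℂ :=
  zeta ψ s χ (cutoff ϖ n k φ)

open Classical in
/-- The coefficients `θ_m(s, χ, ψ)`, for `0 ≤ m ≤ n - 1`. -/
def theta {F : Type*} [NontriviallyNormedField F] [IsUltrametricDist F] [MeasurableSpace F]
    (ϖ : Fˣ) (n m : ℕ) (s : ℂ) (χ : Fˣ →ₜ* ℂˣ) (ψ : AddChar F Circle) : ℂ :=
  if IsUnramified χ then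
    (epsilon ϖ s χ ψ)⁻¹ * LFactor ϖ (n * s) (χ ^ n)
      * (((χ ϖ : ℂˣ) : ℂ) * (residueCard F : ℂ) ^ (-s)) ^ m
      * (if m = n - 1 then (LFactor ϖ (1 - n * s) (χ ^ n)⁻¹)⁻¹ else 1 - (residueCard F : ℂ)⁻¹)
  else if m = 0 then ((χ (-1) : ℂˣ) : ℂ) * (epsilon ϖ s χ ψ)⁻¹
  else 0

end LocalTate

end

set_option linter.unusedSectionVars false

/-! Slice `F^*` into the shells of elements of fixed valuation. With `Q = ‖ϖ‖^s`, a Mellin transform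
becomes a Laurent series in `Q` whose coefficients `mellinCoeff` are integrals over shells, and the
cutoff to a class modulo `n` keeps the exponents in that class. For a Schwartz function the
coefficients vanish far to the left and are geometric far to the right, so the series is rational in
`Q`; this gives every continuation. Fubini and the substitution `x ↦ x * y` show that the
coefficients of `φ̂` are a convolution `b m = ∑ l, g (m + l) * ‖ϖ‖^l * c l`, with `g` the Gauss
integrals of `χ` and `ψ` over shells and `c` the coefficients of `φ` against `χ⁻¹`
(`hasSum_mellinCoeff_fourierWith`). Sorting pairs `(i, l)` with `i - l ≡ k` by the class `j + e` of
`i` (`hasSum_convolution_modEq`) yields the functional equation, whose coefficients are the partial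
generating series of `g`. It holds on a strip where all series converge, hence everywhere by the
identity theorem (`zeta_fourier_eventuallyEq_sum`). It remains to recognize these partial series as
`θ_m`. The case `n = 1` applied to `φ̂`, with Fourier inversion, gives `γ = χ(-1) / G` for the full
series `G` of `g`, and so expresses `ε⁻¹` by `G` (`tateGamma_eventuallyEq`, `epsilon_eventuallyEq`).
For ramified `χ` only `g` at `e(ψ) - e(χ)` survives. For unramified `χ`, with `e = e(ψ)`, `g`
vanishes below `e - 1`, has an exceptional value at `e - 1` and is geometric from `e` on; the
exceptional term produces the separate case `m = n - 1`. -/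

namespace LocalTate

/-! ### Shells, balls and the scaling of Haar measure. -/

section Field

open scoped Pointwise NNReal ENNReal

variable {F : Type*} [NontriviallyNormedField F]

/-- The elements of `F` of valuation `m`. -/
def shell (ϖ : Fˣ) (m : ℤ) : Set F := {x | ‖x‖ = ‖(ϖ : F)‖ ^ m}

variable {ϖ : Fˣ}

lemma mem_shell {m : ℤ} {x : F} : x ∈ shell ϖ m ↔ ‖x‖ = ‖(ϖ : F)‖ ^ m := Iff.rfl

lemma shell_eq_sphere (m : ℤ) : shell ϖ m = Metric.sphere (0 : F) (‖(ϖ : F)‖ ^ m) := by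
  ext x; simp [shell]

lemma norm_pos_of_unit (ϖ : Fˣ) : 0 < ‖(ϖ : F)‖ := norm_pos_iff.2 ϖ.ne_zero

lemma ne_zero_of_mem_shell {m : ℤ} {x : F} (hx : x ∈ shell ϖ m) : x ≠ 0 := by
  rintro rfl
  rw [mem_shell, norm_zero] at hx
  exact (zpow_pos (norm_pos_of_unit ϖ) m).ne hx

lemma isClosed_shell (m : ℤ) : IsClosed (shell ϖ m) := by
  rw [shell_eq_sphere]; exact Metric.isClosed_sphere

lemma isCompact_shell [ProperSpace F] (m : ℤ) : IsCompact (shell ϖ m) := by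
  rw [shell_eq_sphere]; exact isCompact_sphere _ _

lemma measurableSet_shell [MeasurableSpace F] [BorelSpace F] (m : ℤ) :
    MeasurableSet (shell ϖ m) := (isClosed_shell m).measurableSet

lemma zpow_uniformizer_injective (hϖ : IsUniformizer ϖ) :
    Function.Injective (fun m : ℤ => ‖(ϖ : F)‖ ^ m) :=
  zpow_right_injective₀ (norm_pos_of_unit ϖ) hϖ.1.ne

lemma zpow_uniformizer_le_iff (hϖ : IsUniformizer ϖ) {m l : ℤ} :
    ‖(ϖ : F)‖ ^ m ≤ ‖(ϖ : F)‖ ^ l ↔ l ≤ m :=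
  zpow_le_zpow_iff_right_of_lt_one₀ (norm_pos_of_unit ϖ) hϖ.1

lemma zpow_uniformizer_lt_iff (hϖ : IsUniformizer ϖ) {m l : ℤ} :
    ‖(ϖ : F)‖ ^ m < ‖(ϖ : F)‖ ^ l ↔ l < m :=
  zpow_lt_zpow_iff_right_of_lt_one₀ (norm_pos_of_unit ϖ) hϖ.1

lemma exists_mem_shell (hϖ : IsUniformizer ϖ) {x : F} (hx : x ≠ 0) :
    ∃ m : ℤ, x ∈ shell ϖ m := by
  have hr := norm_pos_of_unit ϖ
  obtain ⟨m, hm1, hm2⟩ := exists_mem_Ioc_zpow (norm_pos_iff.2 hx) ((one_lt_inv₀ hr).2 hϖ.1)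
  rw [inv_zpow'] at hm1 hm2
  refine ⟨-(m + 1), ?_⟩
  rw [mem_shell]
  -- Scaling puts the norm in `(‖ϖ‖, 1]`. No element has norm strictly between `‖ϖ‖` and `1`, so
  -- `‖y‖ = 1`.
  set y : F := x * (ϖ : F) ^ (m + 1) with hy
  have hny : ‖y‖ = ‖x‖ * ‖(ϖ : F)‖ ^ (m + 1) := by rw [hy, norm_mul, norm_zpow]
  have h1 : ‖y‖ ≤ 1 := by
    rw [hny]
    calc ‖x‖ * ‖(ϖ : F)‖ ^ (m + 1) ≤ ‖(ϖ : F)‖ ^ (-(m + 1)) * ‖(ϖ : F)‖ ^ (m + 1) := by gcongr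
      _ = 1 := by rw [← zpow_add₀ hr.ne']; simp
  have h2 : ‖(ϖ : F)‖ < ‖y‖ := by
    rw [hny]
    calc ‖(ϖ : F)‖ = ‖(ϖ : F)‖ ^ (-m) * ‖(ϖ : F)‖ ^ (m + 1) := by
          rw [← zpow_add₀ hr.ne']; simp
      _ < _ := by gcongr
  have h3 : ‖y‖ = 1 := le_antisymm h1 (not_lt.1 fun h => absurd (hϖ.2 y h) (not_le.2 h2))
  rw [hny] at h3
  rw [zpow_neg]
  exact eq_inv_of_mul_eq_one_left h3

lemma iUnion_shell (hϖ : IsUniformizer ϖ) : ⋃ m : ℤ, shell ϖ m = ({0}ᶜ : Set F) := by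
  ext x
  simp only [Set.mem_iUnion, Set.mem_compl_iff, Set.mem_singleton_iff]
  exact ⟨fun ⟨m, hm⟩ => ne_zero_of_mem_shell hm, exists_mem_shell hϖ⟩

lemma shell_unique (hϖ : IsUniformizer ϖ) {m l : ℤ} {x : F} (h : x ∈ shell ϖ m)
    (h' : x ∈ shell ϖ l) : m = l :=
  zpow_uniformizer_injective hϖ (h.symm.trans h')

lemma pairwise_disjoint_shell (hϖ : IsUniformizer ϖ) :
    Pairwise (Function.onFun Disjoint (fun m : ℤ => (shell ϖ m : Set F))) := fun _ _ hml =>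
  Set.disjoint_left.2 fun _ hx hx' => hml (shell_unique hϖ hx hx')

lemma mul_mem_shell {m l : ℤ} {x y : F} (hx : x ∈ shell ϖ m) (hy : y ∈ shell ϖ l) :
    x * y ∈ shell ϖ (m + l) := by
  rw [mem_shell] at *
  rw [norm_mul, hx, hy, zpow_add₀ (norm_pos_of_unit ϖ).ne']

lemma zpow_mem_shell (m : ℤ) : ((ϖ ^ m : Fˣ) : F) ∈ shell ϖ m := by
  rw [mem_shell, Units.val_zpow_eq_zpow_val, norm_zpow]

lemma inv_mem_shell {m : ℤ} {x : F} (hx : x ∈ shell ϖ m) : x⁻¹ ∈ shell ϖ (-m) := by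
  rw [mem_shell] at *
  rw [norm_inv, hx, zpow_neg]

lemma mul_mem_shell_iff {m l : ℤ} {x y : F} (hx : x ∈ shell ϖ l) :
    x * y ∈ shell ϖ m ↔ y ∈ shell ϖ (m - l) := by
  constructor <;> intro h
  · have := mul_mem_shell (inv_mem_shell hx) h
    rwa [inv_mul_cancel_left₀ (ne_zero_of_mem_shell hx), neg_add_eq_sub] at this
  · have := mul_mem_shell hx h
    rwa [add_sub_cancel] at this

lemma norm_add_eq_of_lt [IsUltrametricDist F] {x t : F} (h : ‖t‖ < ‖x‖) : ‖x + t‖ = ‖x‖ := by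
  rw [IsUltrametricDist.norm_add_eq_max_of_norm_ne_norm h.ne', max_eq_left h.le]

/-- Above the ball of radius `‖ϖ‖^e`, the norm is at least `‖ϖ‖^(e-1)`. -/
lemma zpow_sub_one_le_norm (hϖ : IsUniformizer ϖ) {x : F} {e : ℤ} (h : ‖(ϖ : F)‖ ^ e < ‖x‖) :
    ‖(ϖ : F)‖ ^ (e - 1) ≤ ‖x‖ := by
  have hx : x ≠ 0 := by
    rintro rfl
    rw [norm_zero] at h
    exact absurd h (not_lt.2 (zpow_pos (norm_pos_of_unit ϖ) e).le)
  obtain ⟨m, hm⟩ := exists_mem_shell hϖ hx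
  rw [mem_shell] at hm
  rw [hm] at h ⊢
  rw [zpow_uniformizer_lt_iff hϖ] at h
  rw [zpow_uniformizer_le_iff hϖ]
  omega

lemma exists_zpow_uniformizer_lt (hϖ : IsUniformizer ϖ) {ε : ℝ} (hε : 0 < ε) :
    ∃ m : ℕ, ‖(ϖ : F)‖ ^ m < ε := exists_pow_lt_of_lt_one hε hϖ.1

lemma ball_one_eq_closedBall (hϖ : IsUniformizer ϖ) :
    Metric.ball (0 : F) 1 = Metric.closedBall (0 : F) ‖(ϖ : F)‖ := by
  ext x
  simp only [Metric.mem_ball, dist_zero_right, Metric.mem_closedBall]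
  exact ⟨hϖ.2 x, fun h => h.trans_lt hϖ.1⟩

lemma closedBall_eq_shell_union (hϖ : IsUniformizer ϖ) (N : ℤ) :
    Metric.closedBall (0 : F) (‖(ϖ : F)‖ ^ (N - 1))
      = shell ϖ (N - 1) ∪ Metric.closedBall (0 : F) (‖(ϖ : F)‖ ^ N) := by
  ext x
  simp only [Metric.mem_closedBall, dist_zero_right, Set.mem_union, mem_shell]
  constructor
  · intro h
    by_cases h' : ‖x‖ ≤ ‖(ϖ : F)‖ ^ N
    · exact Or.inr h'
    · exact Or.inl (le_antisymm h (zpow_sub_one_le_norm hϖ (not_le.1 h')))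
  · rintro (h | h)
    · exact h.le
    · exact h.trans ((zpow_uniformizer_le_iff hϖ).2 (by omega))

lemma disjoint_shell_closedBall (hϖ : IsUniformizer ϖ) (N : ℤ) :
    Disjoint (shell ϖ (N - 1) : Set F) (Metric.closedBall (0 : F) (‖(ϖ : F)‖ ^ N)) := by
  refine Set.disjoint_left.2 fun x hx hx' => ?_
  rw [mem_shell] at hx
  rw [Metric.mem_closedBall, dist_zero_right, hx, zpow_uniformizer_le_iff hϖ] at hx'
  omega

variable [IsUltrametricDist F]

lemma residueCard_pos (hnorm : ‖(ϖ : F)‖ = (residueCard F : ℝ)⁻¹) : 0 < residueCard F := by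
  rcases Nat.eq_zero_or_pos (residueCard F) with h | h
  · rw [h] at hnorm
    simp at hnorm
  · exact h

variable [MeasurableSpace F] [BorelSpace F]

/-- The unit ball is the disjoint union of `q` translates of the maximal ideal. -/
lemma measure_closedBall_one (hq : 0 < residueCard F) (μ : Measure F) [μ.IsAddHaarMeasure] :
    μ (Metric.closedBall 0 1) = residueCard F * μ (Metric.ball 0 1) := by
  classical
  let O := (NormedField.valuation (K := F)).valuationSubring
  have hO : ∀ x : F, x ∈ O ↔ ‖x‖ ≤ 1 := fun x => by
    rw [Valuation.mem_valuationSubring_iff, NormedField.valuation_apply, ← NNReal.coe_le_coe]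
    simp
  let κ := IsLocalRing.ResidueField O
  have hfin : Finite κ := (Nat.card_pos_iff.1 hq).2
  have : Fintype κ := Fintype.ofFinite κ
  let rep : κ → O := Function.surjInv IsLocalRing.residue_surjective
  have hrep : ∀ c, IsLocalRing.residue O (rep c) = c :=
    Function.surjInv_eq IsLocalRing.residue_surjective
  -- The non-units of the closed unit ball are its elements of norm `< 1`, so residue classes are
  -- the cosets of the open unit ball.
  have hres : ∀ x y : O, IsLocalRing.residue O x = IsLocalRing.residue O y ↔
      ‖(x : F) - y‖ < 1 := fun x y => by
    rw [← sub_eq_zero, ← map_sub, IsLocalRing.residue_eq_zero_iff, IsLocalRing.mem_maximalIdeal,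
      mem_nonunits_iff]
    have h1 : ‖(x : F) - y‖ ≤ 1 := (hO _).1 (x - y).2
    constructor
    · intro h
      refine lt_of_le_of_ne h1 fun h' => h ?_
      have h0 : (x : F) - y ≠ 0 := norm_ne_zero_iff.1 (by rw [h']; exact one_ne_zero)
      exact IsUnit.of_mul_eq_one ⟨((x : F) - y)⁻¹, (hO _).2 (by rw [norm_inv, h', inv_one])⟩
        (Subtype.ext (mul_inv_cancel₀ h0))
    · intro h h'
      obtain ⟨w, hw⟩ := h'.exists_right_inv
      have hw' : ‖(x : F) - y‖ * ‖(w : F)‖ = 1 := by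
        rw [← norm_mul, ← norm_one (α := F)]
        exact congrArg (fun z : O => ‖(z : F)‖) hw
      have hw1 : ‖(w : F)‖ ≤ 1 := (hO _).1 w.2
      nlinarith [norm_nonneg ((x : F) - y), norm_nonneg (w : F)]
  have hU : Metric.closedBall (0 : F) 1
      = ⋃ c : κ, (fun y => (rep c : F) + y) '' Metric.ball (0 : F) 1 := by
    ext x
    simp only [Metric.mem_closedBall, dist_zero_right, Set.mem_iUnion, Set.mem_image,
      Metric.mem_ball]
    constructor
    · intro hx
      let x' : O := ⟨x, (hO x).2 hx⟩
      refine ⟨IsLocalRing.residue O x', x - rep (IsLocalRing.residue O x'), ?_, by simp⟩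
      exact (hres x' _).1 (hrep _).symm
    · rintro ⟨c, y, hy, rfl⟩
      exact (IsUltrametricDist.norm_add_le_max _ _).trans
        (max_le ((hO _).1 (rep c).2) hy.le)
  have hdisj : Pairwise (Function.onFun Disjoint
      fun c : κ => (fun y => (rep c : F) + y) '' Metric.ball (0 : F) 1) := by
    intro c d hcd
    refine Set.disjoint_left.2 ?_
    rintro _ ⟨y, hy, rfl⟩ ⟨z, hz, hyz⟩
    apply hcd
    rw [← hrep c, ← hrep d, hres]
    simp only [Metric.mem_ball, dist_zero_right] at hy hz
    have : (rep c : F) - rep d = z + -y := by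
      simp only at hyz
      linear_combination -hyz
    rw [this]
    exact (IsUltrametricDist.norm_add_le_max _ _).trans_lt (max_lt hz (by simpa using hy))
  rw [hU, measure_iUnion hdisj]
  · have : ∀ c : κ, μ ((fun y => (rep c : F) + y) '' Metric.ball (0 : F) 1)
        = μ (Metric.ball (0 : F) 1) := fun c => by
      rw [Set.image_add_left, measure_preimage_add]
    simp only [this, tsum_fintype, Finset.sum_const, Finset.card_univ, nsmul_eq_mul]
    rw [← Nat.card_eq_fintype_card]
    rfl
  · intro c
    rw [Set.image_add_left]
    exact (measurable_const_add _) Metric.isOpen_ball.measurableSet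

variable [ProperSpace F]

/-- The module of a local field is its normalized absolute value. -/
lemma measure_smul_set (hϖ : IsUniformizer ϖ) (hnorm : ‖(ϖ : F)‖ = (residueCard F : ℝ)⁻¹)
    (μ : Measure F) [μ.IsAddHaarMeasure] (c : Fˣ) (s : Set F) :
    μ (c • s) = ‖(c : F)‖₊ * μ s := by
  have hq := residueCard_pos hnorm
  have h0 : μ (Metric.closedBall (0 : F) 1) ≠ 0 :=
    (Metric.measure_closedBall_pos μ 0 one_pos).ne'
  have hT : μ (Metric.closedBall (0 : F) 1) ≠ ⊤ := (isCompact_closedBall 0 1).measure_ne_top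
  have hsm : ∀ u : Fˣ, u • Metric.closedBall (0 : F) 1 = Metric.closedBall (0 : F) ‖(u : F)‖ := by
    intro u
    have : u • Metric.closedBall (0 : F) 1 = (u : F) • Metric.closedBall (0 : F) 1 := rfl
    rw [this, smul_closedBall _ _ zero_le_one]
    simp
  have hunit : ∀ u : Fˣ, ‖(u : F)‖ = 1 → distribHaarChar F u = 1 := fun u hu =>
    distribHaarChar_eq_of_measure_smul_eq_mul (μ := μ) h0 hT (by rw [hsm, hu]; simp)
  -- Multiplication by `ϖ` sends the closed unit ball to the open one, which has index `q`; the
  -- normalization `‖ϖ‖ = q⁻¹` enters here.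
  have hunif : distribHaarChar F ϖ = ‖(ϖ : F)‖₊ := by
    refine distribHaarChar_eq_of_measure_smul_eq_mul (μ := μ) h0 hT ?_
    rw [hsm, ← ball_one_eq_closedBall hϖ, measure_closedBall_one hq, ← mul_assoc]
    have : (‖(ϖ : F)‖₊ : ℝ≥0∞) * residueCard F = 1 := by
      have h : ‖(ϖ : F)‖₊ * (residueCard F : ℝ≥0) = 1 := by
        apply NNReal.coe_injective
        push_cast
        rw [hnorm]
        exact inv_mul_cancel₀ (by exact_mod_cast hq.ne')
      exact_mod_cast congrArg ((↑) : ℝ≥0 → ℝ≥0∞) h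
    rw [this, one_mul]
  rw [← distribHaarChar_mul]
  congr 2
  obtain ⟨m, hm⟩ := exists_mem_shell hϖ c.ne_zero
  have hc : c = (c * (ϖ ^ m)⁻¹) * ϖ ^ m := by simp
  have h1 : ‖((c * (ϖ ^ m)⁻¹ : Fˣ) : F)‖ = 1 := by
    have := mul_mem_shell hm (inv_mem_shell (zpow_mem_shell (ϖ := ϖ) m))
    rw [mem_shell] at this
    simpa using this
  have h2 : distribHaarChar F c = ‖(ϖ : F)‖₊ ^ m := by
    conv_lhs => rw [hc]
    rw [map_mul, hunit _ h1, map_zpow, hunif, one_mul]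
  rw [h2]
  apply NNReal.coe_injective
  exact (NNReal.coe_zpow _ _).trans hm.symm

lemma map_mul_left (hϖ : IsUniformizer ϖ) (hnorm : ‖(ϖ : F)‖ = (residueCard F : ℝ)⁻¹)
    (μ : Measure F) [μ.IsAddHaarMeasure] {c : F} (hc : c ≠ 0) :
    μ.map (fun x => c * x) = ‖c‖₊⁻¹ • μ := by
  ext s hs
  rw [Measure.map_apply (measurable_const_mul c) hs]
  have : (fun x => c * x) ⁻¹' s = (Units.mk0 c hc)⁻¹ • s := by
    ext x
    rw [Set.mem_inv_smul_set_iff]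
    rfl
  rw [this, measure_smul_set hϖ hnorm]
  rw [Measure.smul_apply, Units.val_inv_eq_inv_val, Units.val_mk0, nnnorm_inv]
  rfl

lemma integral_comp_mul_left (hϖ : IsUniformizer ϖ) (hnorm : ‖(ϖ : F)‖ = (residueCard F : ℝ)⁻¹)
    (μ : Measure F) [μ.IsAddHaarMeasure] {c : F} (hc : c ≠ 0) (f : F → ℂ) :
    ∫ x, f (c * x) ∂μ = (‖c‖ : ℂ)⁻¹ * ∫ x, f x ∂μ := by
  have h := (Homeomorph.mulLeft₀ c hc).measurableEmbedding.integral_map (μ := μ) f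
  have h' : μ.map (Homeomorph.mulLeft₀ c hc) = ‖c‖₊⁻¹ • μ := map_mul_left hϖ hnorm μ hc
  rw [h', integral_smul_nnreal_measure] at h
  simp only [Homeomorph.coe_mulLeft₀] at h
  rw [← h, NNReal.smul_def]
  simp

lemma setIntegral_shell_comp_mul_left (hϖ : IsUniformizer ϖ)
    (hnorm : ‖(ϖ : F)‖ = (residueCard F : ℝ)⁻¹)
    (μ : Measure F) [μ.IsAddHaarMeasure] {c : F} {l : ℤ} (hc : c ∈ shell ϖ l) (m : ℤ)
    (f : F → ℂ) :
    ∫ x in shell ϖ m, f (c * x) ∂μ = (‖c‖ : ℂ)⁻¹ * ∫ x in shell ϖ (m + l), f x ∂μ := by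
  rw [← integral_indicator (measurableSet_shell _), ← integral_indicator (measurableSet_shell _),
    ← integral_comp_mul_left hϖ hnorm μ (ne_zero_of_mem_shell hc)]
  congr 1
  ext x
  by_cases hx : x ∈ shell ϖ m
  · rw [Set.indicator_of_mem hx, Set.indicator_of_mem]
    rw [mul_mem_shell_iff hc]
    simpa using hx
  · rw [Set.indicator_of_notMem hx, Set.indicator_of_notMem]
    rw [mul_mem_shell_iff hc]
    simpa using hx

lemma measureReal_closedBall (hϖ : IsUniformizer ϖ) (hnorm : ‖(ϖ : F)‖ = (residueCard F : ℝ)⁻¹)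
    (μ : Measure F) [μ.IsAddHaarMeasure] (m : ℤ) :
    μ.real (Metric.closedBall 0 (‖(ϖ : F)‖ ^ m))
      = ‖(ϖ : F)‖ ^ m * μ.real (Metric.closedBall 0 1) := by
  have : (Metric.closedBall 0 (‖(ϖ : F)‖ ^ m) : Set F)
      = (ϖ ^ m : Fˣ) • Metric.closedBall (0 : F) 1 := by
    have h : (ϖ ^ m : Fˣ) • Metric.closedBall (0 : F) 1
      = ((ϖ ^ m : Fˣ) : F) • Metric.closedBall (0 : F) 1 := rfl
    rw [h, smul_closedBall _ _ zero_le_one]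
    simp
  rw [this, measureReal_def, measure_smul_set hϖ hnorm, ENNReal.toReal_mul, ← measureReal_def,
    ENNReal.coe_toReal, coe_nnnorm, Units.val_zpow_eq_zpow_val, norm_zpow]

lemma measureReal_shell (hϖ : IsUniformizer ϖ) (hnorm : ‖(ϖ : F)‖ = (residueCard F : ℝ)⁻¹)
    (μ : Measure F) [μ.IsAddHaarMeasure] (m : ℤ) :
    μ.real (shell ϖ m)
      = ‖(ϖ : F)‖ ^ m * ((1 - ‖(ϖ : F)‖) * μ.real (Metric.closedBall 0 1)) := by
  have h := closedBall_eq_shell_union hϖ (m + 1)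
  have hd := disjoint_shell_closedBall hϖ (m + 1)
  rw [add_sub_cancel_right] at h hd
  have hμ := measureReal_closedBall hϖ hnorm μ m
  rw [h, measureReal_union hd Metric.isClosed_closedBall.measurableSet
      ((isCompact_shell m).measure_ne_top) ((isCompact_closedBall _ _).measure_ne_top),
    measureReal_closedBall hϖ hnorm, zpow_add_one₀ (norm_pos_of_unit ϖ).ne'] at hμ
  linear_combination hμ

end Field

/-! ### Quasi-characters, additive characters and their conductors. -/

section Characters

variable {F : Type*} [NontriviallyNormedField F]

open Classical in
/-- The extension by zero to `F` of a quasi-character of `F^*`. -/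
noncomputable def extChar (χ : Fˣ →ₜ* ℂˣ) (x : F) : ℂ :=
  if h : x = 0 then 0 else ((χ (Units.mk0 x h) : ℂˣ) : ℂ)

variable (χ : Fˣ →ₜ* ℂˣ)

@[simp] lemma extChar_zero : extChar χ 0 = 0 := dif_pos rfl

lemma extChar_of_ne_zero {x : F} (h : x ≠ 0) :
    extChar χ x = ((χ (Units.mk0 x h) : ℂˣ) : ℂ) := dif_neg h

@[simp] lemma extChar_coe (u : Fˣ) : extChar χ (u : F) = ((χ u : ℂˣ) : ℂ) := by
  rw [extChar_of_ne_zero χ u.ne_zero, Units.mk0_val]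

lemma extChar_ne_zero {x : F} (h : x ≠ 0) : extChar χ x ≠ 0 := by
  rw [extChar_of_ne_zero χ h]; exact Units.ne_zero _

@[simp] lemma extChar_one : extChar χ 1 = 1 := by
  have := extChar_coe χ 1
  simpa using this

lemma extChar_mul (x y : F) : extChar χ (x * y) = extChar χ x * extChar χ y := by
  by_cases hx : x = 0
  · simp [hx]
  by_cases hy : y = 0
  · simp [hy]
  rw [extChar_of_ne_zero χ hx, extChar_of_ne_zero χ hy, extChar_of_ne_zero χ (mul_ne_zero hx hy),
    ← Units.val_mul, ← map_mul]
  congr 2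
  ext
  simp

lemma extChar_inv (x : F) : extChar χ⁻¹ x = (extChar χ x)⁻¹ := by
  by_cases hx : x = 0
  · simp [hx]
  rw [extChar_of_ne_zero _ hx, extChar_of_ne_zero _ hx, ← Units.val_inv_eq_inv_val]
  rfl

lemma extChar_zpow_uniformizer (ϖ : Fˣ) (m : ℤ) :
    extChar χ ((ϖ ^ m : Fˣ) : F) = ((χ ϖ : ℂˣ) : ℂ) ^ m := by
  rw [extChar_coe, map_zpow, Units.val_zpow_eq_zpow_val]

lemma continuousOn_extChar : ContinuousOn (extChar χ) ({0}ᶜ : Set F) := by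
  rw [continuousOn_iff_continuous_domRestrict]
  have : ({0}ᶜ : Set F).domRestrict (extChar χ)
      = fun x : ({0}ᶜ : Set F) => ((χ (Units.mk0 (x : F) x.2) : ℂˣ) : ℂ) := by
    ext x
    exact extChar_of_ne_zero χ x.2
  rw [this]
  refine Units.continuous_val.comp (χ.continuous_toFun.comp ?_)
  rw [Units.isEmbedding_val₀.continuous_iff]
  exact continuous_subtype_val

lemma continuousOn_extChar_shell {ϖ : Fˣ} (m : ℤ) : ContinuousOn (extChar χ) (shell ϖ m) :=
  (continuousOn_extChar χ).mono fun _ hx => ne_zero_of_mem_shell hx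

/-- On each shell, a quasi-character is bounded by a constant times its value at `ϖ^m`. -/
lemma exists_norm_extChar_le [ProperSpace F] (ϖ : Fˣ) :
    ∃ B : ℝ, 0 < B ∧ ∀ (m : ℤ) (x : F), x ∈ shell ϖ m →
      ‖extChar χ x‖ ≤ B * ‖((χ ϖ : ℂˣ) : ℂ)‖ ^ m := by
  obtain ⟨B, hB⟩ := (isCompact_shell (ϖ := ϖ) 0).exists_bound_of_continuousOn
    (continuousOn_extChar_shell χ 0)
  refine ⟨max B 1, by positivity, fun m x hx => ?_⟩
  have h1 : x * ((ϖ ^ (-m) : Fˣ) : F) ∈ shell ϖ 0 := by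
    have := mul_mem_shell hx (zpow_mem_shell (ϖ := ϖ) (-m))
    rwa [add_neg_cancel] at this
  have h2 : x = x * ((ϖ ^ (-m) : Fˣ) : F) * ((ϖ ^ m : Fˣ) : F) := by
    rw [mul_assoc, ← Units.val_mul, ← zpow_add]
    simp
  rw [h2, extChar_mul, norm_mul, extChar_zpow_uniformizer, norm_zpow]
  gcongr
  exact (hB _ h1).trans (le_max_left _ _)

/-- The group `ℂ^*` has no small subgroups. -/
lemma eq_one_of_forall_norm_pow_sub_one_le {z : ℂ} (h : ∀ k : ℕ, ‖z ^ k - 1‖ ≤ 1 / 2) : z = 1 := by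
  by_contra hz
  have hpos : 0 < ‖z - 1‖ := norm_pos_iff.2 (sub_ne_zero.2 hz)
  -- Squaring `w` multiplies `w - 1` by `2 + (w - 1)`, of norm at least `3/2` near `1`, so repeated
  -- squaring would leave the disc unless `z = 1`.
  have hj : ∀ j : ℕ, (3 / 2 : ℝ) ^ j * ‖z - 1‖ ≤ ‖z ^ 2 ^ j - 1‖ := by
    intro j
    induction j with
    | zero => simp
    | succ j ih =>
      set w := z ^ 2 ^ j with hw
      have h1 : z ^ 2 ^ (j + 1) - 1 = (w - 1) * (2 + (w - 1)) := by
        rw [pow_succ, pow_mul, ← hw]; ring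
      have h2 : (3 / 2 : ℝ) ≤ ‖2 + (w - 1)‖ := by
        have h3 := norm_sub_le_norm_add (2 : ℂ) (w - 1)
        have h4 := h (2 ^ j)
        rw [← hw] at h4
        simp only [Complex.norm_ofNat] at h3
        linarith
      rw [h1, norm_mul, pow_succ]
      calc (3 / 2 : ℝ) ^ j * (3 / 2) * ‖z - 1‖ = (3 / 2 : ℝ) ^ j * ‖z - 1‖ * (3 / 2) := by ring
        _ ≤ _ := by gcongr
  obtain ⟨j, hj'⟩ := pow_unbounded_of_one_lt (1 / ‖z - 1‖) (by norm_num : (1 : ℝ) < 3 / 2)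
  have h1 := hj j
  have h2 := h (2 ^ j)
  rw [div_lt_iff₀ hpos] at hj'
  linarith

lemma continuousAt_extChar_one : ContinuousAt (extChar χ) (1 : F) :=
  (continuousOn_extChar χ).continuousAt (isOpen_compl_singleton.mem_nhds one_ne_zero)

variable {ϖ : Fˣ}

lemma exists_of_lt_mulConductor {f : ℕ} (hf : f < mulConductor ϖ χ) :
    ∃ u : Fˣ, ‖(u : F)‖ = 1 ∧ ‖(u : F) - 1‖ ≤ ‖(ϖ : F)‖ ^ f ∧ χ u ≠ 1 := by
  have := Nat.notMem_of_lt_sInf hf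
  simp only [Set.mem_ofPred_eq, not_forall] at this
  obtain ⟨u, h1, h2, h3⟩ := this
  exact ⟨u, h1, h2, h3⟩

lemma mulConductor_eq_zero {χ : Fˣ →ₜ* ℂˣ} (h : IsUnramified χ) : mulConductor ϖ χ = 0 :=
  Nat.sInf_eq_zero.2 (Or.inl fun u hu _ => h u hu)

variable [IsUltrametricDist F]

/-- Small balls around `1` in the units are closed under powers; with the absence of small subgroups
in `ℂ^*` this forces `χ` to be trivial near `1`. -/
lemma norm_pow_sub_one_le {u : F} (hu : ‖u‖ = 1) {δ : ℝ} (hδ : ‖u - 1‖ ≤ δ) (k : ℕ) :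
    ‖u ^ k - 1‖ ≤ δ := by
  induction k with
  | zero => simpa using (norm_nonneg _).trans hδ
  | succ k ih =>
    have : u ^ (k + 1) - 1 = u * (u ^ k - 1) + (u - 1) := by ring
    rw [this]
    refine (IsUltrametricDist.norm_add_le_max _ _).trans (max_le ?_ hδ)
    rwa [norm_mul, hu, one_mul]

lemma norm_nsmul_le' (x : F) (k : ℕ) : ‖k • x‖ ≤ ‖x‖ := by
  rw [nsmul_eq_mul, norm_mul]
  exact mul_le_of_le_one_left (norm_nonneg _) (IsUltrametricDist.norm_natCast_le_one F k)

/-- The infimum defining the conductor is attained once the set is nonempty, which follows from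
continuity at `1` and the absence of small subgroups in `ℂ^*`. -/
lemma mulConductor_spec (hϖ : IsUniformizer ϖ) {u : Fˣ} (hu : ‖(u : F)‖ = 1)
    (hu' : ‖(u : F) - 1‖ ≤ ‖(ϖ : F)‖ ^ mulConductor ϖ χ) : χ u = 1 := by
  have hne : {e : ℕ | ∀ u : Fˣ, ‖(u : F)‖ = 1 → ‖(u : F) - 1‖ ≤ ‖(ϖ : F)‖ ^ e →
      χ u = 1}.Nonempty := by
    obtain ⟨δ, hδ, hχ⟩ := Metric.continuousAt_iff.1 (continuousAt_extChar_one χ) (1 / 2)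
      (by norm_num)
    obtain ⟨m, hm⟩ := exists_zpow_uniformizer_lt hϖ hδ
    refine ⟨m, fun u hu hum => ?_⟩
    ext
    refine eq_one_of_forall_norm_pow_sub_one_le fun k => ?_
    have := hχ (x := (u : F) ^ k) (by
      rw [dist_eq_norm]; exact (norm_pow_sub_one_le hu hum k).trans_lt hm)
    rw [dist_eq_norm, extChar_one, ← Units.val_pow_eq_pow_val, extChar_coe, map_pow,
      Units.val_pow_eq_pow_val] at this
    exact this.le
  exact Nat.sInf_mem hne u hu hu'

lemma mulConductor_pos (hϖ : IsUniformizer ϖ) {χ : Fˣ →ₜ* ℂˣ} (h : ¬IsUnramified χ) :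
    1 ≤ mulConductor ϖ χ := by
  by_contra hlt
  refine h fun u hu => mulConductor_spec χ hϖ hu ?_
  rw [Nat.lt_one_iff.1 (not_le.1 hlt), pow_zero, sub_eq_add_neg]
  exact (IsUltrametricDist.norm_add_le_max _ _).trans (by simp [hu])

variable {ψ : AddChar F Circle}

/-- Both properties are needed for the infimum in `ℤ` to be attained. Continuity and the absence of
small subgroups give the first; a point where `ψ ≠ 1` gives the lower bound. -/
lemma addConductor_aux (hϖ : IsUniformizer ϖ) (hψc : Continuous ψ) (hψ : ψ ≠ 1) :
    {e : ℤ | ∀ x : F, ‖x‖ ≤ ‖(ϖ : F)‖ ^ e → ψ x = 1}.Nonempty ∧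
      BddBelow {e : ℤ | ∀ x : F, ‖x‖ ≤ ‖(ϖ : F)‖ ^ e → ψ x = 1} := by
  constructor
  · have hc : ContinuousAt (fun x => (ψ x : ℂ)) 0 :=
      (continuous_induced_dom.comp hψc).continuousAt
    obtain ⟨δ, hδ, hχ⟩ := Metric.continuousAt_iff.1 hc (1 / 2) (by norm_num)
    obtain ⟨m, hm⟩ := exists_zpow_uniformizer_lt hϖ hδ
    refine ⟨m, fun x hx => ?_⟩
    apply Circle.coe_injective
    rw [Circle.coe_one]
    refine eq_one_of_forall_norm_pow_sub_one_le fun k => ?_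
    have := hχ (x := k • x) (by
      rw [dist_eq_norm, sub_zero]
      rw [zpow_natCast] at hx
      exact ((norm_nsmul_le' x k).trans hx).trans_lt hm)
    rw [dist_eq_norm, AddChar.map_nsmul_eq_pow, AddChar.map_zero_eq_one] at this
    simpa using this.le
  · obtain ⟨x, hx⟩ : ∃ x, ψ x ≠ 1 := by
      by_contra! h
      exact hψ (DFunLike.ext _ _ h)
    have hx0 : x ≠ 0 := by
      rintro rfl
      exact hx (AddChar.map_zero_eq_one ψ)
    obtain ⟨m, hm⟩ := exists_mem_shell hϖ hx0
    refine ⟨m, fun e he => ?_⟩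
    by_contra hlt
    refine hx (he x ?_)
    rw [mem_shell.1 hm, zpow_uniformizer_le_iff hϖ]
    omega

lemma addConductor_spec (hϖ : IsUniformizer ϖ) (hψc : Continuous ψ) (hψ : ψ ≠ 1) {x : F}
    (hx : ‖x‖ ≤ ‖(ϖ : F)‖ ^ addConductor ϖ ψ) : ψ x = 1 :=
  Int.csInf_mem (addConductor_aux hϖ hψc hψ).1 (addConductor_aux hϖ hψc hψ).2 x hx

lemma exists_of_lt_addConductor (hϖ : IsUniformizer ϖ) (hψc : Continuous ψ) (hψ : ψ ≠ 1) {f : ℤ}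
    (hf : f < addConductor ϖ ψ) : ∃ x : F, ‖x‖ ≤ ‖(ϖ : F)‖ ^ f ∧ ψ x ≠ 1 := by
  by_contra! h
  exact absurd (csInf_le (addConductor_aux hϖ hψc hψ).2 h) (not_le.2 hf)

end Characters

/-! ### Fourier transform of Schwartz functions and the self-dual measure. -/

section Fourier

open scoped NNReal

variable {F : Type*} [NontriviallyNormedField F] {ϖ : Fˣ}

/-- A Lebesgue number for the level sets makes local constancy uniform on a ball containing the
support. Outside it, a small translation preserves the norm, so both values vanish. -/
lemma IsSchwartzBruhat.exists_bounds [IsUltrametricDist F] [ProperSpace F]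
    (hϖ : IsUniformizer ϖ) {φ : F → ℂ} (hφ : IsSchwartzBruhat φ) :
    ∃ N M : ℤ, (∀ x t : F, ‖t‖ ≤ ‖(ϖ : F)‖ ^ N → φ (x + t) = φ x) ∧
      ∀ x : F, ‖(ϖ : F)‖ ^ M < ‖x‖ → φ x = 0 := by
  have hr := norm_pos_of_unit ϖ
  obtain ⟨R, hR⟩ := hφ.2.isBounded.subset_closedBall (0 : F)
  obtain ⟨M', hM'⟩ := pow_unbounded_of_one_lt R ((one_lt_inv₀ hr).2 hϖ.1)
  have hM : R < ‖(ϖ : F)‖ ^ (-(M' : ℤ)) := by rwa [zpow_neg, zpow_natCast, ← inv_pow]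
  have hvan : ∀ x : F, ‖(ϖ : F)‖ ^ (-(M' : ℤ)) < ‖x‖ → φ x = 0 := fun x hx => by
    by_contra h
    have := hR (subset_tsupport φ h)
    rw [Metric.mem_closedBall, dist_zero_right] at this
    linarith
  obtain ⟨δ, hδ, hcov⟩ := lebesgue_number_lemma_of_metric
    (isCompact_closedBall (0 : F) (‖(ϖ : F)‖ ^ (-(M' : ℤ)))) (c := fun c : ℂ => φ ⁻¹' {c})
    (fun c => hφ.1.isOpen_fiber c) (fun x _ => Set.mem_iUnion.2 ⟨φ x, rfl⟩)
  obtain ⟨N, hN⟩ := exists_zpow_uniformizer_lt hϖ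
    (lt_min hδ (zpow_pos hr (-(M' : ℤ))))
  refine ⟨N, -M', fun x t ht => ?_, hvan⟩
  rw [zpow_natCast] at ht
  have ht1 := ht.trans_lt (hN.trans_le (min_le_left _ _))
  have ht2 := ht.trans_lt (hN.trans_le (min_le_right _ _))
  by_cases hx : ‖x‖ ≤ ‖(ϖ : F)‖ ^ (-(M' : ℤ))
  · obtain ⟨c, hc⟩ := hcov x (by rwa [Metric.mem_closedBall, dist_zero_right])
    have h1 : φ x = c := hc (Metric.mem_ball_self hδ)
    have h2 : φ (x + t) = c := hc (by rwa [Metric.mem_ball, dist_eq_norm, add_sub_cancel_left])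
    rw [h1, h2]
  · have hx' := not_le.1 hx
    rw [hvan x hx', hvan]
    rwa [norm_add_eq_of_lt (ht2.trans hx')]

lemma isSchwartzBruhat_of_bounds [ProperSpace F] {φ : F → ℂ} {N M : ℤ}
    (h1 : ∀ x t : F, ‖t‖ ≤ ‖(ϖ : F)‖ ^ N → φ (x + t) = φ x)
    (h2 : ∀ x : F, ‖(ϖ : F)‖ ^ M < ‖x‖ → φ x = 0) : IsSchwartzBruhat φ := by
  constructor
  · rw [IsLocallyConstant.iff_eventually_eq]
    intro x
    filter_upwards [Metric.ball_mem_nhds x (zpow_pos (norm_pos_of_unit ϖ) N)] with y hy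
    rw [Metric.mem_ball, dist_eq_norm] at hy
    rw [← h1 x (y - x) hy.le, add_sub_cancel]
  · refine HasCompactSupport.intro (isCompact_closedBall (0 : F) (‖(ϖ : F)‖ ^ M)) fun x hx => ?_
    rw [Metric.mem_closedBall, dist_zero_right, not_le] at hx
    exact h2 x hx

lemma IsSchwartzBruhat.continuous {φ : F → ℂ} (hφ : IsSchwartzBruhat φ) : Continuous φ :=
  hφ.1.continuous

lemma IsSchwartzBruhat.exists_norm_le {φ : F → ℂ} (hφ : IsSchwartzBruhat φ) :
    ∃ C : ℝ, 0 ≤ C ∧ ∀ x, ‖φ x‖ ≤ C := by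
  obtain ⟨C, hC⟩ := hφ.2.exists_bound_of_continuous hφ.continuous
  exact ⟨C, (norm_nonneg _).trans (hC 0), hC⟩

variable [MeasurableSpace F] [BorelSpace F]

lemma IsSchwartzBruhat.integrable {φ : F → ℂ} (hφ : IsSchwartzBruhat φ) (μ : Measure F)
    [IsFiniteMeasureOnCompacts μ] : Integrable φ μ :=
  hφ.continuous.integrable_of_hasCompactSupport hφ.2

/-- An integral vanishes if a translation multiplies the integrand by a factor `≠ 1`. -/
lemma setIntegral_eq_zero_of_translate (μ : Measure F) [μ.IsAddHaarMeasure] {s : Set F}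
    (hs : MeasurableSet s) {t : F} (hst : ∀ x, x + t ∈ s ↔ x ∈ s) {g : F → ℂ} {a : ℂ} (ha : a ≠ 1)
    (hg : ∀ x ∈ s, g (x + t) = a * g x) : ∫ x in s, g x ∂μ = 0 := by
  have h : ∫ x in s, g x ∂μ = a * ∫ x in s, g x ∂μ := by
    calc ∫ x in s, g x ∂μ = ∫ x, s.indicator g (x + t) ∂μ := by
          rw [integral_add_right_eq_self, integral_indicator hs]
      _ = ∫ x, a * s.indicator g x ∂μ := ?_
      _ = _ := by rw [integral_const_mul, integral_indicator hs]
    congr 1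
    ext x
    by_cases hx : x ∈ s
    · rw [Set.indicator_of_mem hx, Set.indicator_of_mem ((hst x).2 hx), hg x hx]
    · rw [Set.indicator_of_notMem hx, Set.indicator_of_notMem (fun h => hx ((hst x).1 h)),
        mul_zero]
  have h' : (1 - a) * ∫ x in s, g x ∂μ = 0 := by linear_combination h
  exact (mul_eq_zero.1 h').resolve_left (sub_ne_zero.2 ha.symm)

variable {ψ : AddChar F Circle}

lemma continuous_addChar_coe (hψc : Continuous ψ) : Continuous (fun x => (ψ x : ℂ)) :=
  continuous_induced_dom.comp hψc

lemma measurable_addChar (hψc : Continuous ψ) : Measurable (fun x => (ψ x : ℂ)) :=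
  (continuous_addChar_coe hψc).measurable

lemma addChar_coe_ne_one {x : F} (h : ψ x ≠ 1) : (ψ x : ℂ) ≠ 1 := fun h' =>
  h (Circle.coe_injective (by rw [h', Circle.coe_one]))

variable [IsUltrametricDist F]

/-- Orthogonality of characters on a ball, which is a compact subgroup: the integral is the volume
or zero according to whether `z ↦ ψ (z * c)` is trivial there. -/
lemma setIntegral_closedBall_addChar (hϖ : IsUniformizer ϖ) (hψc : Continuous ψ) (hψ : ψ ≠ 1)
    (μ : Measure F) [μ.IsAddHaarMeasure] (m : ℤ) (c : F) :
    ∫ z in Metric.closedBall 0 (‖(ϖ : F)‖ ^ m), (ψ (z * c) : ℂ) ∂μ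
      = (Metric.closedBall 0 (‖(ϖ : F)‖ ^ (addConductor ϖ ψ - m))).indicator
        (fun _ => (μ.real (Metric.closedBall 0 (‖(ϖ : F)‖ ^ m)) : ℂ)) c := by
  have hr := norm_pos_of_unit ϖ
  by_cases hc : c ∈ Metric.closedBall 0 (‖(ϖ : F)‖ ^ (addConductor ϖ ψ - m))
  · rw [Set.indicator_of_mem hc]
    rw [Metric.mem_closedBall, dist_zero_right] at hc
    have : ∀ z ∈ Metric.closedBall 0 (‖(ϖ : F)‖ ^ m), (ψ (z * c) : ℂ) = 1 := fun z hz => by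
      rw [Metric.mem_closedBall, dist_zero_right] at hz
      rw [addConductor_spec hϖ hψc hψ, Circle.coe_one]
      rw [norm_mul]
      calc ‖z‖ * ‖c‖ ≤ ‖(ϖ : F)‖ ^ m * ‖(ϖ : F)‖ ^ (addConductor ϖ ψ - m) := by gcongr
        _ = _ := by rw [← zpow_add₀ hr.ne', add_sub_cancel]
    rw [setIntegral_congr_fun Metric.isClosed_closedBall.measurableSet this]
    simp
  · rw [Set.indicator_of_notMem hc]
    rw [Metric.mem_closedBall, dist_zero_right, not_le] at hc
    have hc' := zpow_sub_one_le_norm hϖ hc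
    have hc0 : 0 < ‖c‖ := (zpow_pos hr _).trans_le hc'
    -- Minimality of the conductor gives `z` just outside the kernel ball with `ψ z ≠ 1`;
    -- translating by `z / c` stays in the ball of integration and multiplies the integrand by `ψ
    -- z`.
    obtain ⟨z, hz, hz1⟩ := exists_of_lt_addConductor hϖ hψc hψ (sub_one_lt (addConductor ϖ ψ))
    have ht : ‖z / c‖ ≤ ‖(ϖ : F)‖ ^ m := by
      rw [norm_div, div_le_iff₀ hc0]
      refine hz.trans ?_
      calc ‖(ϖ : F)‖ ^ (addConductor ϖ ψ - 1)
          = ‖(ϖ : F)‖ ^ m * ‖(ϖ : F)‖ ^ (addConductor ϖ ψ - m - 1) := by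
            rw [← zpow_add₀ hr.ne']; congr 1; ring
        _ ≤ _ := by gcongr
    refine setIntegral_eq_zero_of_translate μ Metric.isClosed_closedBall.measurableSet
      (t := z / c) (fun x => ?_) (addChar_coe_ne_one hz1) (fun x _ => ?_)
    · simp only [Metric.mem_closedBall, dist_zero_right]
      constructor
      · intro h
        have : x = (x + z / c) + -(z / c) := by ring
        rw [this]
        exact (IsUltrametricDist.norm_add_le_max _ _).trans (max_le h (by rwa [norm_neg]))
      · intro h
        exact (IsUltrametricDist.norm_add_le_max _ _).trans (max_le h ht)
    · rw [add_mul, div_mul_cancel₀ _ (norm_pos_iff.1 hc0), AddChar.map_add_eq_mul, Circle.coe_mul,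
        mul_comm]

/-- A period of `φ` bounds the support of its transform: translating by `z / x`, a period of `φ`
with `ψ z ≠ 1`, scales the integral by `ψ z`. Dually, `fourierWith_add` turns bounded support into
periods. -/
lemma fourierWith_eq_zero (hϖ : IsUniformizer ϖ) (hψc : Continuous ψ) (hψ : ψ ≠ 1)
    (μ : Measure F) [μ.IsAddHaarMeasure] {φ : F → ℂ} {N : ℤ}
    (h1 : ∀ x t : F, ‖t‖ ≤ ‖(ϖ : F)‖ ^ N → φ (x + t) = φ x) (x : F)
    (hx : ‖(ϖ : F)‖ ^ (addConductor ϖ ψ - N) < ‖x‖) : fourierWith ψ μ φ x = 0 := by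
  have hr := norm_pos_of_unit ϖ
  have hx' := zpow_sub_one_le_norm hϖ hx
  have hx0 : 0 < ‖x‖ := (zpow_pos hr _).trans_le hx'
  obtain ⟨z, hz, hz1⟩ := exists_of_lt_addConductor hϖ hψc hψ (sub_one_lt (addConductor ϖ ψ))
  have ht : ‖z / x‖ ≤ ‖(ϖ : F)‖ ^ N := by
    rw [norm_div, div_le_iff₀ hx0]
    refine hz.trans ?_
    calc ‖(ϖ : F)‖ ^ (addConductor ϖ ψ - 1)
        = ‖(ϖ : F)‖ ^ N * ‖(ϖ : F)‖ ^ (addConductor ϖ ψ - N - 1) := by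
          rw [← zpow_add₀ hr.ne']; congr 1; ring
      _ ≤ _ := by gcongr
  rw [fourierWith, ← setIntegral_univ]
  refine setIntegral_eq_zero_of_translate μ MeasurableSet.univ (t := z / x) (fun _ => by simp)
    (addChar_coe_ne_one hz1) (fun y _ => ?_)
  rw [h1 y _ ht, mul_add, mul_div_cancel₀ _ (norm_pos_iff.1 hx0), AddChar.map_add_eq_mul,
    Circle.coe_mul]
  ring

lemma fourierWith_add (hϖ : IsUniformizer ϖ) (hψc : Continuous ψ) (hψ : ψ ≠ 1)
    (μ : Measure F) {φ : F → ℂ} {M : ℤ}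
    (h2 : ∀ x : F, ‖(ϖ : F)‖ ^ M < ‖x‖ → φ x = 0) (x t : F)
    (ht : ‖t‖ ≤ ‖(ϖ : F)‖ ^ (addConductor ϖ ψ - M)) :
    fourierWith ψ μ φ (x + t) = fourierWith ψ μ φ x := by
  unfold fourierWith
  congr 1
  ext y
  by_cases hy : ‖(ϖ : F)‖ ^ M < ‖y‖
  · rw [h2 y hy, zero_mul, zero_mul]
  · have : ψ (t * y) = 1 := by
      refine addConductor_spec hϖ hψc hψ ?_
      rw [norm_mul]
      calc ‖t‖ * ‖y‖ ≤ ‖(ϖ : F)‖ ^ (addConductor ϖ ψ - M) * ‖(ϖ : F)‖ ^ M := by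
            gcongr
            exact not_lt.1 hy
        _ = _ := by rw [← zpow_add₀ (norm_pos_of_unit ϖ).ne', sub_add_cancel]
    rw [add_mul, AddChar.map_add_eq_mul, this, mul_one]

variable [ProperSpace F]

lemma IsSchwartzBruhat.fourierWith (hϖ : IsUniformizer ϖ) (hψc : Continuous ψ) (hψ : ψ ≠ 1)
    (μ : Measure F) [μ.IsAddHaarMeasure] {φ : F → ℂ} (hφ : IsSchwartzBruhat φ) :
    IsSchwartzBruhat (fourierWith ψ μ φ) := by
  obtain ⟨N, M, h1, h2⟩ := hφ.exists_bounds hϖ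
  exact isSchwartzBruhat_of_bounds (fourierWith_add hϖ hψc hψ μ h2)
    (fourierWith_eq_zero hϖ hψc hψ μ h1)

lemma integrable_mul_mul_addChar (hψc : Continuous ψ) (μ ν : Measure F) [SFinite μ]
    [SFinite ν] {f g : F → ℂ} (hf : Integrable f ν) (hg : Integrable g μ) :
    Integrable (Function.uncurry fun x y => f x * (g y * (ψ (x * y) : ℂ))) (ν.prod μ) := by
  have h1 : Integrable (fun p : F × F => f p.1 * g p.2) (ν.prod μ) := hf.mul_prod hg
  have h2 : Integrable (fun p : F × F => (f p.1 * g p.2) * (ψ (p.1 * p.2) : ℂ)) (ν.prod μ) := by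
    refine h1.mul_bdd (c := 1) ?_ (Eventually.of_forall fun p => (Circle.norm_coe _).le)
    exact ((measurable_addChar hψc).comp (measurable_fst.mul measurable_snd)).aestronglyMeasurable
  refine h2.congr (Eventually.of_forall fun p => ?_)
  simp only [Function.uncurry]
  ring

lemma integral_mul_mul_addChar (μ : Measure F) (f : F → ℂ) (a : ℂ) (y : F) :
    ∫ x, f x * (a * (ψ (x * y) : ℂ)) ∂μ = a * ∫ x, f x * (ψ (x * y) : ℂ) ∂μ := by
  rw [← integral_const_mul]
  congr 1
  ext x
  ring

lemma integral_integral_mul_addChar_swap (hψc : Continuous ψ) (μ ν : Measure F) [SFinite μ]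
    [SFinite ν] {f g : F → ℂ} (hf : Integrable f ν) (hg : Integrable g μ) :
    ∫ x, f x * ∫ y, g y * (ψ (x * y) : ℂ) ∂μ ∂ν
      = ∫ y, g y * ∫ x, f x * (ψ (x * y) : ℂ) ∂ν ∂μ := by
  calc ∫ x, f x * ∫ y, g y * (ψ (x * y) : ℂ) ∂μ ∂ν
      = ∫ x, ∫ y, f x * (g y * (ψ (x * y) : ℂ)) ∂μ ∂ν := by simp only [integral_const_mul]
    _ = ∫ y, ∫ x, f x * (g y * (ψ (x * y) : ℂ)) ∂ν ∂μ :=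
        integral_integral_swap (integrable_mul_mul_addChar hψc μ ν hf hg)
    _ = _ := by simp only [integral_mul_mul_addChar]

/-- Fourier inversion, up to a constant. -/
lemma fourierWith_fourierWith (hϖ : IsUniformizer ϖ)
    (hnorm : ‖(ϖ : F)‖ = (residueCard F : ℝ)⁻¹) (hψc : Continuous ψ) (hψ : ψ ≠ 1)
    (μ : Measure F) [μ.IsAddHaarMeasure] {φ : F → ℂ} (hφ : IsSchwartzBruhat φ) (x : F) :
    fourierWith ψ μ (fourierWith ψ μ φ) x
      = (‖(ϖ : F)‖ ^ addConductor ϖ ψ * μ.real (Metric.closedBall 0 1) ^ 2 : ℝ) * φ (-x) := by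
  have hr := norm_pos_of_unit ϖ
  obtain ⟨N, M, h1, h2⟩ := hφ.exists_bounds hϖ
  set e := addConductor ϖ ψ with he
  -- The inner transform vanishes off `B`. Restricting to this compact set legitimizes Fubini, since
  -- `z ↦ ψ (x * z)` is not integrable on all of `F`.
  set B := Metric.closedBall (0 : F) (‖(ϖ : F)‖ ^ (e - N)) with hB
  have hBm : MeasurableSet B := Metric.isClosed_closedBall.measurableSet
  have hsub : fourierWith ψ μ (fourierWith ψ μ φ) x
      = ∫ z in B, (ψ (x * z) : ℂ) * ∫ y, φ y * (ψ (z * y) : ℂ) ∂μ ∂μ := by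
    rw [fourierWith, ← setIntegral_eq_integral_of_forall_compl_eq_zero (s := B)]
    · refine setIntegral_congr_fun hBm fun z _ => ?_
      exact mul_comm _ _
    · intro z hz
      rw [hB, Metric.mem_closedBall, dist_zero_right, not_le] at hz
      rw [fourierWith_eq_zero hϖ hψc hψ μ h1 z hz, zero_mul]
  have hψi : Integrable (fun z => (ψ (x * z) : ℂ)) (μ.restrict B) := by
    refine ContinuousOn.integrableOn_compact (isCompact_closedBall _ _) (Continuous.continuousOn ?_)
    exact (continuous_addChar_coe hψc).comp (continuous_const_mul x)
  rw [hsub, integral_integral_mul_addChar_swap hψc μ (μ.restrict B) hψi (hφ.integrable μ)]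
  have hin : ∀ y, ∫ z in B, (ψ (x * z) : ℂ) * (ψ (z * y) : ℂ) ∂μ
      = (Metric.closedBall 0 (‖(ϖ : F)‖ ^ N)).indicator (fun _ => (μ.real B : ℂ)) (x + y) := by
    intro y
    have := setIntegral_closedBall_addChar hϖ hψc hψ μ (e - N) (x + y)
    rw [← he, sub_sub_cancel] at this
    rw [← this]
    refine setIntegral_congr_fun hBm fun z _ => ?_
    rw [mul_add, AddChar.map_add_eq_mul, Circle.coe_mul, mul_comm x z]
  simp only [hin]
  have hs : MeasurableSet ((fun y => x + y) ⁻¹' Metric.closedBall 0 (‖(ϖ : F)‖ ^ N)) :=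
    (measurable_const_add x) Metric.isClosed_closedBall.measurableSet
  -- The kernel localizes `y` to the ball of radius `‖ϖ‖^N` about `-x`, where `φ` is constant. The
  -- product of the volumes of this ball and of `B` is the constant of the inversion formula.
  have hfun : (fun y => φ y * (Metric.closedBall 0 (‖(ϖ : F)‖ ^ N)).indicator
      (fun _ => (μ.real B : ℂ)) (x + y))
      = ((fun y => x + y) ⁻¹' Metric.closedBall 0 (‖(ϖ : F)‖ ^ N)).indicator
        (fun _ => φ (-x) * (μ.real B : ℂ)) := by
    ext y
    by_cases hy : x + y ∈ Metric.closedBall 0 (‖(ϖ : F)‖ ^ N)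
    · rw [Set.indicator_of_mem hy, Set.indicator_of_mem (by exact hy)]
      rw [Metric.mem_closedBall, dist_zero_right] at hy
      rw [← h1 (-x) (x + y) hy, neg_add_cancel_left]
    · rw [Set.indicator_of_notMem hy, Set.indicator_of_notMem (by exact hy), mul_zero]
  rw [hfun, integral_indicator_const _ hs, measureReal_def, measure_preimage_add,
    ← measureReal_def, measureReal_closedBall hϖ hnorm, hB, measureReal_closedBall hϖ hnorm,
    Complex.real_smul, zpow_sub₀ hr.ne']
  have : (‖(ϖ : F)‖ : ℂ) ^ N ≠ 0 := zpow_ne_zero _ (by exact_mod_cast hr.ne')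
  push_cast
  field_simp

lemma fourierWith_smul_measure (k : ℝ≥0) (μ : Measure F) (φ : F → ℂ) (x : F) :
    fourierWith ψ (k • μ) φ x = k * fourierWith ψ μ φ x := by
  rw [fourierWith, integral_smul_nnreal_measure, NNReal.smul_def, Complex.real_smul, fourierWith]

lemma isSelfDual_selfDualMeasure (hϖ : IsUniformizer ϖ)
    (hnorm : ‖(ϖ : F)‖ = (residueCard F : ℝ)⁻¹) (hψc : Continuous ψ) (hψ : ψ ≠ 1) :
    IsSelfDual ψ (selfDualMeasure ψ) := by
  have hex : ∃ μ : Measure F, IsSelfDual ψ μ := by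
    let μ : Measure F := Measure.addHaar
    set c : ℝ := ‖(ϖ : F)‖ ^ addConductor ϖ ψ * μ.real (Metric.closedBall 0 1) ^ 2 with hc
    have hV : 0 < μ.real (Metric.closedBall (0 : F) 1) :=
      ENNReal.toReal_pos (Metric.measure_closedBall_pos μ 0 one_pos).ne'
        (isCompact_closedBall 0 1).measure_ne_top
    have hc0 : 0 < c := mul_pos (zpow_pos (norm_pos_of_unit ϖ) _) (pow_pos hV 2)
    have hs := Real.sqrt_pos.2 hc0
    -- Scaling the measure by `k` scales the double transform by `k²`, which must cancel `c`.
    let k : ℝ≥0 := ⟨(Real.sqrt c)⁻¹, (inv_pos.2 hs).le⟩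
    have hk : (k : ℝ) * k * c = 1 := by
      change (Real.sqrt c)⁻¹ * (Real.sqrt c)⁻¹ * c = 1
      rw [← mul_inv, Real.mul_self_sqrt hc0.le, inv_mul_cancel₀ hc0.ne']
    have hk0 : k ≠ 0 := fun h => by
      rw [h] at hk
      simp at hk
    refine ⟨k • μ, Measure.IsAddHaarMeasure.nnreal_smul μ hk0, fun φ hφ x => ?_⟩
    rw [fourierWith_smul_measure]
    have h1 : fourierWith ψ (k • μ) φ = fun x => (k : ℂ) * fourierWith ψ μ φ x :=
      funext fun x => fourierWith_smul_measure k μ φ x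
    have h2 : fourierWith ψ μ (fun x => (k : ℂ) * fourierWith ψ μ φ x) x
        = k * fourierWith ψ μ (fourierWith ψ μ φ) x := by
      simp only [fourierWith, mul_assoc]
      rw [integral_const_mul]
    rw [h1, h2, fourierWith_fourierWith hϖ hnorm hψc hψ μ hφ, ← hc, ← mul_assoc, ← mul_assoc]
    have : ((k : ℝ) : ℂ) * (k : ℝ) * (c : ℂ) = 1 := by exact_mod_cast hk
    rw [this, one_mul]
  rw [selfDualMeasure, dif_pos hex]
  exact hex.choose_spec

end Fourier

/-! ### Mellin coefficients, Gauss integrals and their convolution. -/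

section Coefficients

variable {F : Type*} [NontriviallyNormedField F] [MeasurableSpace F]

/-- The coefficient of `(q^{-s})^m` in the Mellin transform of `f` against `χ`. -/
noncomputable def mellinCoeff (ϖ : Fˣ) (μ : Measure F) (χ : Fˣ →ₜ* ℂˣ) (f : F → ℂ) (m : ℤ) : ℂ :=
  ((‖(ϖ : F)‖ : ℂ) ^ m)⁻¹ * ∫ x in shell ϖ m, extChar χ x * f x ∂μ

/-- The Gauss sums (integrals) attached to `χ` and `ψ`. -/
noncomputable def gaussCoeff (ϖ : Fˣ) (μ : Measure F) (χ : Fˣ →ₜ* ℂˣ) (ψ : AddChar F Circle)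
    (m : ℤ) : ℂ :=
  mellinCoeff ϖ μ χ (fun x => (ψ x : ℂ)) m

variable {ϖ : Fˣ} (χ : Fˣ →ₜ* ℂˣ)

lemma norm_uniformizer_zpow_ne_zero (ϖ : Fˣ) (m : ℤ) : ((‖(ϖ : F)‖ : ℂ)) ^ m ≠ 0 :=
  zpow_ne_zero _ (by exact_mod_cast (norm_pos_of_unit ϖ).ne')

variable [BorelSpace F]

lemma mellinCoeff_congr (μ : Measure F) {f g : F → ℂ} {m : ℤ} (h : ∀ x ∈ shell ϖ m, f x = g x) :
    mellinCoeff ϖ μ χ f m = mellinCoeff ϖ μ χ g m := by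
  rw [mellinCoeff, mellinCoeff]
  congr 1
  exact setIntegral_congr_fun (measurableSet_shell m) fun x hx => by simp only [h x hx]

lemma mellinCoeff_const (μ : Measure F) (c : ℂ) (m : ℤ) :
    mellinCoeff ϖ μ χ (fun _ => c) m = c * mellinCoeff ϖ μ χ 1 m := by
  simp only [mellinCoeff, integral_mul_const, Pi.one_apply, mul_one]
  ring

lemma mellinCoeff_zero (μ : Measure F) (m : ℤ) :
    mellinCoeff ϖ μ χ (fun _ => 0) m = 0 := by
  simp [mellinCoeff]

variable [IsUltrametricDist F] [ProperSpace F]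

lemma integrableOn_extChar (μ : Measure F) [IsFiniteMeasureOnCompacts μ] (m : ℤ) :
    IntegrableOn (extChar χ) (shell ϖ m) μ :=
  (continuousOn_extChar_shell χ m).integrableOn_compact (isCompact_shell m)

/-- Invariance of the measure `d^*x` under multiplication. -/
lemma mellinCoeff_comp_mul_left (hϖ : IsUniformizer ϖ)
    (hnorm : ‖(ϖ : F)‖ = (residueCard F : ℝ)⁻¹) (μ : Measure F) [μ.IsAddHaarMeasure] {c : F}
    {l : ℤ} (hc : c ∈ shell ϖ l) (f : F → ℂ) (m : ℤ) :
    mellinCoeff ϖ μ χ (fun x => f (c * x)) m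
      = (extChar χ c)⁻¹ * mellinCoeff ϖ μ χ f (m + l) := by
  have h := setIntegral_shell_comp_mul_left hϖ hnorm μ hc m
    (fun x => extChar χ x * f x)
  have h1 : ∀ x, extChar χ (c * x) * f (c * x) = extChar χ c * (extChar χ x * f (c * x)) :=
    fun x => by rw [extChar_mul]; ring
  simp only [h1, integral_const_mul] at h
  rw [mem_shell.1 hc] at h
  have h0 := extChar_ne_zero χ (ne_zero_of_mem_shell hc)
  have hl := norm_uniformizer_zpow_ne_zero ϖ l
  have hm := norm_uniformizer_zpow_ne_zero ϖ m
  rw [mellinCoeff, mellinCoeff, zpow_add₀ (by exact_mod_cast (norm_pos_of_unit ϖ).ne')]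
  push_cast at h
  field_simp at h ⊢
  linear_combination h

lemma mellinCoeff_one (hϖ : IsUniformizer ϖ)
    (hnorm : ‖(ϖ : F)‖ = (residueCard F : ℝ)⁻¹) (μ : Measure F) [μ.IsAddHaarMeasure] (m : ℤ) :
    mellinCoeff ϖ μ χ 1 m = mellinCoeff ϖ μ χ 1 0 * ((χ ϖ : ℂˣ) : ℂ) ^ m := by
  have h := mellinCoeff_comp_mul_left χ hϖ hnorm μ (zpow_mem_shell (ϖ := ϖ) m) 1 0
  rw [zero_add, extChar_zpow_uniformizer] at h
  have h0 : ((χ ϖ : ℂˣ) : ℂ) ^ m ≠ 0 := zpow_ne_zero _ (Units.ne_zero _)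
  have h1 : (fun x : F => (1 : F → ℂ) (((ϖ ^ m : Fˣ) : F) * x)) = 1 := rfl
  rw [h1] at h
  rw [h]
  field_simp

/-- The coefficients of the Mellin transform of a Schwartz function vanish for `m ≪ 0` and form a
geometric progression for `m ≫ 0`. -/
lemma exists_mellinCoeff_eq (hϖ : IsUniformizer ϖ)
    (hnorm : ‖(ϖ : F)‖ = (residueCard F : ℝ)⁻¹) (μ : Measure F) [μ.IsAddHaarMeasure]
    {φ : F → ℂ} (hφ : IsSchwartzBruhat φ) :
    ∃ (M N : ℤ) (C : ℂ), (∀ m < M, mellinCoeff ϖ μ χ φ m = 0) ∧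
      ∀ m, N ≤ m → mellinCoeff ϖ μ χ φ m = C * ((χ ϖ : ℂˣ) : ℂ) ^ m := by
  obtain ⟨N, M, h1, h2⟩ := hφ.exists_bounds hϖ
  refine ⟨M, N, φ 0 * mellinCoeff ϖ μ χ 1 0, fun m hm => ?_, fun m hm => ?_⟩
  · rw [mellinCoeff_congr χ μ (g := fun _ => 0), mellinCoeff_zero]
    intro x hx
    refine h2 x ?_
    rwa [mem_shell.1 hx, zpow_uniformizer_lt_iff hϖ]
  · rw [mellinCoeff_congr χ μ (g := fun _ => φ 0), mellinCoeff_const, mellinCoeff_one χ hϖ hnorm,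
      mul_assoc]
    intro x hx
    rw [← h1 0 x, zero_add]
    rwa [mem_shell.1 hx, zpow_uniformizer_le_iff hϖ]

variable {ψ : AddChar F Circle}

lemma gaussCoeff_of_le (hϖ : IsUniformizer ϖ)
    (hnorm : ‖(ϖ : F)‖ = (residueCard F : ℝ)⁻¹) (hψc : Continuous ψ) (hψ : ψ ≠ 1)
    (μ : Measure F) [μ.IsAddHaarMeasure] {j : ℤ} (hj : addConductor ϖ ψ ≤ j) :
    gaussCoeff ϖ μ χ ψ j = mellinCoeff ϖ μ χ 1 0 * ((χ ϖ : ℂˣ) : ℂ) ^ j := by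
  rw [gaussCoeff, ← mellinCoeff_one χ hϖ hnorm]
  refine mellinCoeff_congr χ μ fun x hx => ?_
  rw [addConductor_spec hϖ hψc hψ, Circle.coe_one, Pi.one_apply]
  rwa [mem_shell.1 hx, zpow_uniformizer_le_iff hϖ]

/-- Take `t` of norm at most `‖ϖ‖^(j+f)` with `ψ t ≠ 1`. On the shell, `x + t = x * (1 + t / x)`
with `1 + t / x` in `1 + 𝔭^f`, so `χ` is unchanged while `ψ` is multiplied by `ψ t`. The condition
`1 ≤ f` makes the translation preserve the shell. -/
lemma gaussCoeff_eq_zero_of_lt (hϖ : IsUniformizer ϖ) (hψc : Continuous ψ) (hψ : ψ ≠ 1)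
    (μ : Measure F) [μ.IsAddHaarMeasure] {f : ℕ} (hf : 1 ≤ f)
    (hχ : ∀ u : Fˣ, ‖(u : F)‖ = 1 → ‖(u : F) - 1‖ ≤ ‖(ϖ : F)‖ ^ f → χ u = 1) {j : ℤ}
    (hj : j + f < addConductor ϖ ψ) :
    gaussCoeff ϖ μ χ ψ j = 0 := by
  have hr := norm_pos_of_unit ϖ
  obtain ⟨t, ht, ht1⟩ := exists_of_lt_addConductor hϖ hψc hψ hj
  have htx : ∀ x ∈ shell ϖ j, ‖t‖ < ‖x‖ := fun x hx => by
    rw [mem_shell.1 hx]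
    exact ht.trans_lt ((zpow_uniformizer_lt_iff hϖ).2 (by omega))
  rw [gaussCoeff, mellinCoeff, setIntegral_eq_zero_of_translate μ (measurableSet_shell j) (t := t)
    (fun x => ?_) (addChar_coe_ne_one ht1) (fun x hx => ?_), mul_zero]
  · constructor
    · intro h
      have h1 : ‖-t‖ < ‖x + t‖ := by
        rw [norm_neg]
        exact htx _ h
      have h2 := norm_add_eq_of_lt h1
      rw [add_neg_cancel_right] at h2
      rw [mem_shell, h2]
      exact h
    · intro h
      rw [mem_shell, norm_add_eq_of_lt (htx x h)]
      exact h
  · have hx0 := ne_zero_of_mem_shell hx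
    have hsum := norm_add_eq_of_lt (htx x hx)
    have hx1 : x + t ≠ 0 := norm_ne_zero_iff.1 (by rw [hsum]; exact norm_ne_zero_iff.2 hx0)
    have hu0 : 1 + t / x ≠ 0 := by
      have : 1 + t / x = (x + t) / x := by field_simp
      rw [this]
      exact div_ne_zero hx1 hx0
    have hχu : extChar χ (1 + t / x) = 1 := by
      rw [extChar_of_ne_zero χ hu0, hχ, Units.val_one]
      · have : 1 + t / x = (x + t) / x := by field_simp
        rw [Units.val_mk0, this, norm_div, hsum, div_self (norm_ne_zero_iff.2 hx0)]
      · rw [Units.val_mk0, add_sub_cancel_left, norm_div, mem_shell.1 hx,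
          div_le_iff₀ (zpow_pos hr j), ← zpow_natCast, ← zpow_add₀ hr.ne', add_comm]
        exact ht
    have hxt : x + t = x * (1 + t / x) := by field_simp
    rw [AddChar.map_add_eq_mul, Circle.coe_mul]
    conv_lhs => rw [hxt, extChar_mul, hχu]
    ring

/-- Below the critical valuation an additive translation moves only `ψ`; above it, multiplication by
a unit near `1` moves only `χ`. Either way the integral equals a nontrivial multiple of itself. -/
lemma gaussCoeff_eq_zero_of_ramified (hϖ : IsUniformizer ϖ)
    (hnorm : ‖(ϖ : F)‖ = (residueCard F : ℝ)⁻¹) (hψc : Continuous ψ) (hψ : ψ ≠ 1)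
    (μ : Measure F) [μ.IsAddHaarMeasure] (hχ : ¬IsUnramified χ) {j : ℤ}
    (hj : j ≠ relConductor ϖ ψ χ) : gaussCoeff ϖ μ χ ψ j = 0 := by
  have hr := norm_pos_of_unit ϖ
  rw [relConductor] at hj
  have hpos := mulConductor_pos hϖ hχ
  rcases lt_or_gt_of_ne hj with h | h
  · exact gaussCoeff_eq_zero_of_lt χ hϖ hψc hψ μ hpos
      (fun u hu hu' => mulConductor_spec χ hϖ hu hu') (by omega)
  -- This `a` is the least natural number with `a + j ≥ e(ψ)`, so that `ψ ((u - 1) * x) = 1`. It is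
  -- below `e(χ)`; when the truncation gives `a = 0`, this uses `1 ≤ e(χ)`.
  · set a := (addConductor ϖ ψ - j).toNat with ha
    obtain ⟨u, hu1, hu2, hu3⟩ := exists_of_lt_mulConductor χ (ϖ := ϖ) (f := a) (by omega)
    have hus : (u : F) ∈ shell ϖ 0 := by rw [mem_shell, hu1, zpow_zero]
    have h1 := mellinCoeff_comp_mul_left χ hϖ hnorm μ hus (fun x => (ψ x : ℂ)) j
    rw [add_zero, mellinCoeff_congr χ μ (g := fun x => (ψ x : ℂ)), extChar_coe] at h1
    · have hχu : ((χ u : ℂˣ) : ℂ) ≠ 1 := fun h' => hu3 (Units.ext h')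
      have hχ0 : ((χ u : ℂˣ) : ℂ) ≠ 0 := Units.ne_zero _
      have h2 : (((χ u : ℂˣ) : ℂ) - 1) * mellinCoeff ϖ μ χ (fun x => (ψ x : ℂ)) j = 0 := by
        field_simp at h1
        linear_combination h1
      exact (mul_eq_zero.1 h2).resolve_left (sub_ne_zero.2 hχu)
    · intro x hx
      have : (u : F) * x = x + (u - 1) * x := by ring
      rw [this, AddChar.map_add_eq_mul, addConductor_spec hϖ hψc hψ (x := ((u : F) - 1) * x),
        mul_one]
      rw [norm_mul, mem_shell.1 hx]
      calc ‖(u : F) - 1‖ * ‖(ϖ : F)‖ ^ j ≤ ‖(ϖ : F)‖ ^ a * ‖(ϖ : F)‖ ^ j := by gcongr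
        _ = ‖(ϖ : F)‖ ^ ((a : ℤ) + j) := by rw [zpow_add₀ hr.ne', zpow_natCast]
        _ ≤ _ := by rw [zpow_uniformizer_le_iff hϖ]; omega

lemma extChar_eq_of_unramified (hχ : IsUnramified χ) {m : ℤ} {x : F} (hx : x ∈ shell ϖ m) :
    extChar χ x = ((χ ϖ : ℂˣ) : ℂ) ^ m := by
  have h1 : x * ((ϖ ^ (-m) : Fˣ) : F) ∈ shell ϖ 0 := by
    have := mul_mem_shell hx (zpow_mem_shell (ϖ := ϖ) (-m))
    rwa [add_neg_cancel] at this
  have h2 : x = x * ((ϖ ^ (-m) : Fˣ) : F) * ((ϖ ^ m : Fˣ) : F) := by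
    rw [mul_assoc, ← Units.val_mul, ← zpow_add]
    simp
  rw [h2, extChar_mul, extChar_zpow_uniformizer, extChar_of_ne_zero χ (ne_zero_of_mem_shell h1),
    hχ, Units.val_one, one_mul]
  rw [Units.val_mk0, mem_shell.1 h1, zpow_zero]

lemma mellinCoeff_one_zero_of_unramified (hϖ : IsUniformizer ϖ)
    (hnorm : ‖(ϖ : F)‖ = (residueCard F : ℝ)⁻¹) (μ : Measure F) [μ.IsAddHaarMeasure]
    (hχ : IsUnramified χ) :
    mellinCoeff ϖ μ χ 1 0 = (1 - (‖(ϖ : F)‖ : ℂ)) * (μ.real (Metric.closedBall 0 1) : ℂ) := by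
  rw [mellinCoeff, setIntegral_congr_fun (g := fun _ => (1 : ℂ)) (measurableSet_shell 0)]
  · rw [setIntegral_const, measureReal_shell hϖ hnorm, zpow_zero, zpow_zero, Complex.real_smul]
    push_cast
    ring
  · intro x hx
    simp only [Pi.one_apply, mul_one]
    rw [extChar_eq_of_unramified χ hχ hx, zpow_zero]

/-- The shell is the difference of the balls of index `e - 1` and `e`. Over the larger `ψ`
integrates to zero, over the smaller to the volume, hence the negative sign. -/
lemma gaussCoeff_pred_of_unramified (hϖ : IsUniformizer ϖ)
    (hnorm : ‖(ϖ : F)‖ = (residueCard F : ℝ)⁻¹) (hψc : Continuous ψ) (hψ : ψ ≠ 1)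
    (μ : Measure F) [μ.IsAddHaarMeasure] (hχ : IsUnramified χ) :
    gaussCoeff ϖ μ χ ψ (addConductor ϖ ψ - 1)
      = -(‖(ϖ : F)‖ : ℂ) * (μ.real (Metric.closedBall 0 1) : ℂ)
        * ((χ ϖ : ℂˣ) : ℂ) ^ (addConductor ϖ ψ - 1) := by
  have hr := norm_pos_of_unit ϖ
  set e := addConductor ϖ ψ with he
  have h0 : ∫ z in Metric.closedBall 0 (‖(ϖ : F)‖ ^ (e - 1)), (ψ z : ℂ) ∂μ = 0 := by
    have := setIntegral_closedBall_addChar hϖ hψc hψ μ (e - 1) 1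
    rw [← he, sub_sub_cancel, zpow_one, Set.indicator_of_notMem] at this
    · simpa using this
    · rw [Metric.mem_closedBall, dist_zero_right, norm_one, not_le]
      exact hϖ.1
  have h1 : ∫ z in Metric.closedBall 0 (‖(ϖ : F)‖ ^ e), (ψ z : ℂ) ∂μ
      = μ.real (Metric.closedBall 0 (‖(ϖ : F)‖ ^ e)) := by
    have := setIntegral_closedBall_addChar hϖ hψc hψ μ e 1
    rw [← he, sub_self, zpow_zero, Set.indicator_of_mem] at this
    · simpa using this
    · simp
  have hint : ∀ m : ℤ, IntegrableOn (fun z => (ψ z : ℂ))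
      (Metric.closedBall 0 (‖(ϖ : F)‖ ^ m)) μ := fun m =>
    (continuous_addChar_coe hψc).continuousOn.integrableOn_compact (isCompact_closedBall _ _)
  have hint' : IntegrableOn (fun z => (ψ z : ℂ)) (shell ϖ (e - 1)) μ :=
    (continuous_addChar_coe hψc).continuousOn.integrableOn_compact (isCompact_shell _)
  rw [closedBall_eq_shell_union hϖ, setIntegral_union (disjoint_shell_closedBall hϖ e)
    Metric.isClosed_closedBall.measurableSet hint' (hint e), h1,
    measureReal_closedBall hϖ hnorm] at h0
  rw [gaussCoeff, mellinCoeff, setIntegral_congr_fun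
    (g := fun z => ((χ ϖ : ℂˣ) : ℂ) ^ (e - 1) * (ψ z : ℂ)) (measurableSet_shell _)
    (fun x hx => by simp only [extChar_eq_of_unramified χ hχ hx]), integral_const_mul]
  have h2 : ∫ z in shell ϖ (e - 1), (ψ z : ℂ) ∂μ
      = -((‖(ϖ : F)‖ : ℂ) ^ (e - 1) * (‖(ϖ : F)‖ : ℂ) * μ.real (Metric.closedBall 0 1)) := by
    have h3 : ((‖(ϖ : F)‖ : ℂ)) ^ e = (‖(ϖ : F)‖ : ℂ) ^ (e - 1) * (‖(ϖ : F)‖ : ℂ) := by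
      rw [← zpow_add_one₀ (by exact_mod_cast hr.ne'), sub_add_cancel]
    rw [← h3]
    push_cast at h0
    linear_combination h0
  rw [h2]
  have := norm_uniformizer_zpow_ne_zero ϖ (e - 1)
  field_simp

/-- The coefficients of `φ̂` are a multiplicative convolution of those of `φ` with Gauss sums. -/
lemma hasSum_mellinCoeff_fourierWith (hϖ : IsUniformizer ϖ)
    (hnorm : ‖(ϖ : F)‖ = (residueCard F : ℝ)⁻¹) (hψc : Continuous ψ)
    (μ : Measure F) [μ.IsAddHaarMeasure] {φ : F → ℂ} (hφ : IsSchwartzBruhat φ) (m : ℤ) :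
    HasSum (fun l : ℤ => gaussCoeff ϖ μ χ ψ (m + l)
        * ((‖(ϖ : F)‖ : ℂ) ^ l * mellinCoeff ϖ μ χ⁻¹ φ l))
      (mellinCoeff ϖ μ χ (fourierWith ψ μ φ) m) := by
  have hm := norm_uniformizer_zpow_ne_zero ϖ m
  have hχi : Integrable (extChar χ) (μ.restrict (shell ϖ m)) := integrableOn_extChar χ μ m
  have hφi := hφ.integrable μ
  have hI : mellinCoeff ϖ μ χ (fourierWith ψ μ φ) m = ((‖(ϖ : F)‖ : ℂ) ^ m)⁻¹ *
      ∫ y in ⋃ l : ℤ, shell ϖ l, φ y * ∫ x in shell ϖ m, extChar χ x * (ψ (x * y) : ℂ) ∂μ ∂μ := by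
    rw [iUnion_shell hϖ, restrict_compl_singleton,
      ← integral_integral_mul_addChar_swap hψc μ _ hχi hφi]
    rfl
  have hint : Integrable (fun y => φ y * ∫ x in shell ϖ m, extChar χ x * (ψ (x * y) : ℂ) ∂μ) μ := by
    have := (integrable_mul_mul_addChar hψc μ (μ.restrict (shell ϖ m)) hχi hφi).integral_prod_right
    simpa only [Function.uncurry, integral_mul_mul_addChar] using this
  have hS := (hasSum_integral_iUnion (fun l => measurableSet_shell l)
    (pairwise_disjoint_shell hϖ) hint.integrableOn).mul_left (((‖(ϖ : F)‖ : ℂ) ^ m)⁻¹)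
  rw [hI]
  refine hS.congr_fun ?_
  intro l
  have hl := norm_uniformizer_zpow_ne_zero ϖ l
  -- Substituting `x ↦ x * y` moves the inner integral to the shell `m + l` and releases the factor
  -- `χ(y)⁻¹`.
  have hK : ∀ y ∈ shell ϖ l, φ y * ∫ x in shell ϖ m, extChar χ x * (ψ (x * y) : ℂ) ∂μ
      = ((‖(ϖ : F)‖ : ℂ) ^ m * gaussCoeff ϖ μ χ ψ (m + l)) * (extChar χ⁻¹ y * φ y) := by
    intro y hy
    have := mellinCoeff_comp_mul_left χ hϖ hnorm μ hy (fun x => (ψ x : ℂ)) m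
    rw [mellinCoeff, ← gaussCoeff, inv_mul_eq_iff_eq_mul₀ hm] at this
    simp only [mul_comm y] at this
    rw [this, extChar_inv]
    ring
  rw [setIntegral_congr_fun (measurableSet_shell l) hK, integral_const_mul, mellinCoeff]
  field_simp

end Coefficients

/-! ### Laurent series along residue classes. -/

section Series

lemma summable_of_norm_le_geometric {E : Type*} [NormedAddCommGroup E] [CompleteSpace E]
    {f : ℤ → E} {M : ℤ} {K ρ : ℝ} (hρ0 : 0 < ρ) (hρ : ρ < 1) (h0 : ∀ m < M, f m = 0)
    (h1 : ∀ m, ‖f m‖ ≤ K * ρ ^ m) : Summable f := by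
  have hinj : Function.Injective (fun j : ℕ => M + j) := fun a b h => by
    simpa using h
  rw [← hinj.summable_iff]
  · refine Summable.of_norm_bounded (g := fun j : ℕ => K * ρ ^ M * ρ ^ j)
      ((summable_geometric_of_lt_one hρ0.le hρ).mul_left _) fun j => ?_
    refine (h1 _).trans (le_of_eq ?_)
    rw [zpow_add₀ hρ0.ne', zpow_natCast, mul_assoc]
  · intro m hm
    refine h0 m ?_
    by_contra h
    exact hm ⟨(m - M).toNat, by simp; omega⟩

/-- The generating function in the residue class `k` modulo `n` of a sequence that is given by `a`
on `[M, N)`, by `C w^m` from `N` on, and vanishes below `M`. -/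
noncomputable def ratSeries (n : ℕ) (k M N : ℤ) (a : ℤ → ℂ) (C w z : ℂ) : ℂ :=
  ∑ m ∈ Finset.Ico M N, (if m ≡ k [ZMOD n] then a m * z ^ m else 0)
    + C * ((w * z) ^ (N + (k - N) % n) * (1 - (w * z) ^ n)⁻¹)

lemma hasSum_ratSeries {n : ℕ} (hn : 1 ≤ n) (k : ℤ) {M N : ℤ} {a : ℤ → ℂ} {C w z : ℂ}
    (ha : ∀ m < M, a m = 0) (haN : ∀ m, N ≤ m → a m = C * w ^ m) (hw : w ≠ 0) (hz : z ≠ 0)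
    (hwz : ‖w * z‖ < 1) :
    HasSum (fun m : ℤ => if m ≡ k [ZMOD n] then a m * z ^ m else 0)
      (ratSeries n k M N a C w z) := by
  have hn0 : (0 : ℤ) < n := by omega
  set f : ℤ → ℂ := fun m => if m ≡ k [ZMOD n] then a m * z ^ m else 0 with hf
  have hsplit : f = fun m => (if m ∈ Finset.Ico M N then f m else 0)
      + (if N ≤ m then f m else 0) := by
    ext m
    by_cases h1 : N ≤ m
    · simp [h1, not_lt.2 h1]
    · by_cases h2 : M ≤ m
      · simp [h1, h2, not_le.1 h1]
      · simp [h1, h2, hf, ha m (not_le.1 h2)]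
  rw [hsplit]
  refine HasSum.add ?_ ?_
  · have : ∑ m ∈ Finset.Ico M N, f m
        = ∑ m ∈ Finset.Ico M N, (if m ∈ Finset.Ico M N then f m else 0) :=
      Finset.sum_congr rfl fun m hm => by rw [if_pos hm]
    rw [this]
    exact hasSum_sum_of_ne_finset_zero fun m hm => if_neg hm
  -- The least integer `≥ N` congruent to `k`; from there the surviving terms are geometric with
  -- ratio `(w * z) ^ n`.
  · set N' := N + (k - N) % n with hN'
    have hmod := Int.emod_nonneg (k - N) hn0.ne'
    have hmod2 := Int.emod_lt_of_pos (k - N) hn0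
    have hdiv : N' = k - n * ((k - N) / n) := by
      have := Int.emod_add_mul_ediv (k - N) n
      omega
    have hinj : Function.Injective (fun t : ℕ => N' + n * (t : ℤ)) := fun a b h => by
      simp only [add_right_inj] at h
      exact Int.ofNat_inj.1 (Int.eq_of_mul_eq_mul_left hn0.ne' h)
    rw [← hinj.hasSum_iff]
    · have hgeo : HasSum (fun t : ℕ => C * ((w * z) ^ N' * ((w * z) ^ n) ^ t))
          (C * ((w * z) ^ N' * (1 - (w * z) ^ n)⁻¹)) := by
        have hξ : ‖(w * z) ^ n‖ < 1 := by
          rw [norm_pow]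
          exact pow_lt_one₀ (norm_nonneg _) hwz (by omega)
        exact ((hasSum_geometric_of_norm_lt_one hξ).mul_left ((w * z) ^ N')).mul_left C
      convert hgeo using 1
      ext t
      have hle : N ≤ N' + n * (t : ℤ) := by
        have : 0 ≤ n * (t : ℤ) := by positivity
        omega
      have hcong : N' + n * (t : ℤ) ≡ k [ZMOD n] := by
        rw [Int.modEq_iff_dvd]
        exact ⟨(k - N) / n - t, by rw [hdiv]; ring⟩
      simp only [Function.comp, if_pos hle, hf, if_pos hcong, haN _ hle]
      rw [mul_assoc, ← mul_zpow, ← pow_mul, zpow_add₀ (mul_ne_zero hw hz)]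
      norm_cast
    · intro m hm
      by_contra h
      have h1 : N ≤ m := by
        by_contra h'
        exact h (if_neg h')
      have h2 : m ≡ k [ZMOD n] := by
        by_contra h'
        exact h (by rw [if_pos h1, hf]; exact if_neg h')
      obtain ⟨c, hc⟩ := Int.modEq_iff_dvd.1 h2
      refine hm ⟨((k - N) / n - c).toNat, ?_⟩
      have h3 : m = N' + n * ((k - N) / n - c) := by rw [hdiv]; linear_combination -hc
      have h4 : 0 ≤ (k - N) / n - c := by
        by_contra h'
        have : n * ((k - N) / n - c) ≤ n * (-1 : ℤ) :=
          mul_le_mul_of_nonneg_left (by omega) hn0.le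
        omega
      simp only
      rw [Int.toNat_of_nonneg h4, ← h3]

/-- Splitting a multiplicative convolution of Laurent series along residue classes. -/
lemma hasSum_convolution_modEq {n : ℕ} (hn : 1 ≤ n) (k e : ℤ) {b c g : ℤ → ℂ} {x : ℂ} (hx : x ≠ 0)
    (hb : ∀ m, HasSum (fun l => g (m + l) * c l) (b m))
    (hg : Summable fun j => ‖g j * x ^ j‖) (hc : Summable fun l => ‖c l * (x ^ l)⁻¹‖)
    {G Z : ℕ → ℂ}
    (hG : ∀ j < n, HasSum (fun i : ℤ => if i ≡ j + e [ZMOD n] then g i * x ^ i else 0) (G j))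
    (hZ : ∀ j < n, HasSum
      (fun l : ℤ => if l ≡ j + e - k [ZMOD n] then c l * (x ^ l)⁻¹ else 0) (Z j)) :
    HasSum (fun m : ℤ => if m ≡ k [ZMOD n] then b m * x ^ m else 0)
      (∑ j ∈ Finset.range n, G j * Z j) := by
  have hn0 : (0 : ℤ) < n := by omega
  -- Here `p = (i, l)` stands for `i = m + l`. The condition `i - l ≡ k` splits over the unique `j <
  -- n` with `i ≡ j + e`, which forces `l ≡ j + e - k`; each piece is a product of two series.
  let P : ℤ × ℤ → ℂ := fun p =>
    if p.1 - p.2 ≡ k [ZMOD n] then (g p.1 * x ^ p.1) * (c p.2 * (x ^ p.2)⁻¹) else 0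
  have hnorm_ite : ∀ (q : Prop) [Decidable q] (y : ℂ), ‖if q then y else 0‖ ≤ ‖y‖ := by
    intro q _ y
    split_ifs
    · exact le_rfl
    · simp
  have hP : HasSum P (∑ j ∈ Finset.range n, G j * Z j) := by
    have hPj : P = fun p => ∑ j ∈ Finset.range n,
        (if p.1 ≡ j + e [ZMOD n] then g p.1 * x ^ p.1 else 0)
          * (if p.2 ≡ j + e - k [ZMOD n] then c p.2 * (x ^ p.2)⁻¹ else 0) := by
      ext ⟨i, l⟩
      have hr0 := Int.emod_nonneg (i - e) hn0.ne'
      have hr1 := Int.emod_lt_of_pos (i - e) hn0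
      have hjr : ∀ j < n, (i ≡ j + e [ZMOD n] ↔ j = ((i - e) % n).toNat) := by
        intro j hj
        have h1 : i ≡ j + e [ZMOD n] ↔ i - e ≡ j [ZMOD n] := by
          rw [Int.modEq_iff_dvd, Int.modEq_iff_dvd]
          have : (j : ℤ) + e - i = j - (i - e) := by ring
          rw [this]
        have hjj : (j : ℤ) % n = j := Int.emod_eq_of_lt (by omega) (by omega)
        rw [h1, Int.ModEq, hjj]
        omega
      rw [Finset.sum_eq_single ((i - e) % n).toNat]
      · have h1 : i ≡ (((i - e) % n).toNat : ℤ) + e [ZMOD n] :=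
          (hjr _ (by omega)).2 rfl
        have h2 : i - l ≡ k [ZMOD n] ↔
            l ≡ (((i - e) % n).toNat : ℤ) + e - k [ZMOD n] := by
          rw [Int.modEq_iff_dvd] at h1
          rw [Int.modEq_iff_dvd, Int.modEq_iff_dvd, ← dvd_neg]
          have : -(k - (i - l)) + ((((i - e) % n).toNat : ℤ) + e - i)
              = (((i - e) % n).toNat : ℤ) + e - k - l := by ring
          rw [← this, dvd_add_left h1]
        simp only [P, if_pos h1]
        by_cases h3 : i - l ≡ k [ZMOD n]
        · rw [if_pos h3, if_pos (h2.1 h3)]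
        · rw [if_neg h3, if_neg (fun h => h3 (h2.2 h)), mul_zero]
      · intro j hj hne
        rw [if_neg (fun h => hne ((hjr j (Finset.mem_range.1 hj)).1 h)), zero_mul]
      · intro h
        exact absurd (Finset.mem_range.2 (by omega)) h
    rw [hPj]
    refine hasSum_sum fun j hj => ?_
    have hj' := Finset.mem_range.1 hj
    have h1 : Summable fun i : ℤ => ‖if i ≡ j + e [ZMOD n] then g i * x ^ i else 0‖ :=
      hg.of_nonneg_of_le (fun _ => norm_nonneg _) fun i => hnorm_ite _ _
    have h2 : Summable fun l : ℤ => ‖if l ≡ j + e - k [ZMOD n] then c l * (x ^ l)⁻¹ else 0‖ :=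
      hc.of_nonneg_of_le (fun _ => norm_nonneg _) fun l => hnorm_ite _ _
    have h3 := summable_mul_of_summable_norm h1 h2
    have h4 := (hG j hj').mul (hZ j hj') h3
    exact h4
  -- In the coordinates `(m, l)`, summing over `l` first recovers the convolution `b m`.
  let E : ℤ × ℤ ≃ ℤ × ℤ :=
    { toFun := fun p => (p.1 + p.2, p.2)
      invFun := fun p => (p.1 - p.2, p.2)
      left_inv := fun p => by simp
      right_inv := fun p => by simp }
  have hPE : HasSum (P ∘ E) (∑ j ∈ Finset.range n, G j * Z j) := E.hasSum_iff.2 hP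
  refine hPE.prod_fiberwise fun m => ?_
  have h1 : ∀ l, (P ∘ E) (m, l) = if m ≡ k [ZMOD n] then x ^ m * (g (m + l) * c l) else 0 := by
    intro l
    simp only [P, E, Function.comp, Equiv.coe_fn_mk, add_sub_cancel_right]
    split_ifs
    · have := zpow_ne_zero l hx
      rw [zpow_add₀ hx]
      field_simp
    · rfl
  simp only [h1]
  split_ifs
  · rw [mul_comm]
    exact (hb m).mul_left _
  · exact hasSum_zero

end Series

/-! ### Complex powers of the norm, and the Mellin integral as a series. -/

section Uniformizer

variable {F : Type*} [NontriviallyNormedField F]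

lemma norm_zpow_cpow (ϖ : Fˣ) (m : ℤ) (s : ℂ) :
    ((‖(ϖ : F)‖ ^ m : ℝ) : ℂ) ^ s = ((‖(ϖ : F)‖ : ℂ) ^ s) ^ m := by
  have hr := norm_pos_of_unit ϖ
  have hr' : (‖(ϖ : F)‖ : ℂ) ≠ 0 := by exact_mod_cast hr.ne'
  rw [Complex.cpow_def_of_ne_zero (by exact_mod_cast (zpow_pos hr m).ne'),
    Complex.cpow_def_of_ne_zero hr', ← Complex.exp_int_mul, ← Complex.ofReal_log hr.le,
    ← Complex.ofReal_log (zpow_pos hr m).le, Real.log_zpow]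
  congr 1
  push_cast
  ring

lemma norm_uniformizer_cpow_ne_zero (ϖ : Fˣ) (s : ℂ) : (‖(ϖ : F)‖ : ℂ) ^ s ≠ 0 := by
  rw [Complex.cpow_ne_zero_iff]
  exact Or.inl (by exact_mod_cast (norm_pos_of_unit ϖ).ne')

end Uniformizer

section Mellin

open scoped ENNReal

variable {F : Type*} [NontriviallyNormedField F] [MeasurableSpace F] [BorelSpace F]

lemma range_units_val : Set.range (Units.val : Fˣ → F) = {0}ᶜ := by
  ext x
  exact ⟨fun ⟨u, hu⟩ => hu ▸ u.ne_zero, fun hx => ⟨Units.mk0 x hx, rfl⟩⟩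

lemma measurableEmbedding_units_val : MeasurableEmbedding (Units.val : Fˣ → F) where
  injective := Units.val_injective
  measurable := comap_measurable _
  measurableSet_image' := by
    rintro s ⟨t, ht, rfl⟩
    rw [Set.image_preimage_eq_inter_range]
    refine ht.inter ?_
    rw [range_units_val]
    exact isOpen_compl_singleton.measurableSet

/-- Integrals over `F^*` for `d^*x` in terms of integrals over `F`. -/
lemma integral_mulMeasure (ψ : AddChar F Circle) {h : F → ℂ}
    (hh : IntegrableOn (fun x => (‖x‖⁻¹ : ℝ) • h x) {0}ᶜ (selfDualMeasure ψ)) :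
    Integrable (fun u : Fˣ => h u) (mulMeasure ψ) ∧
      ∫ u : Fˣ, h u ∂(mulMeasure ψ)
        = ∫ x in {0}ᶜ, (‖x‖⁻¹ : ℝ) • h x ∂(selfDualMeasure ψ) := by
  have hmeas : Measurable (fun x : Fˣ => ENNReal.ofReal ‖(x : F)‖⁻¹) :=
    (measurableEmbedding_units_val.measurable.norm.inv).ennreal_ofReal
  have htop : ∀ᵐ x : Fˣ ∂((selfDualMeasure ψ).comap (Units.val : Fˣ → F)),
      ENNReal.ofReal ‖(x : F)‖⁻¹ < ⊤ := Eventually.of_forall fun _ => ENNReal.ofReal_lt_top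
  have hreal : ∀ x : Fˣ, (ENNReal.ofReal ‖(x : F)‖⁻¹).toReal • h x
      = (fun x : F => (‖x‖⁻¹ : ℝ) • h x) x := fun x => by
    rw [ENNReal.toReal_ofReal (inv_nonneg.2 (norm_nonneg _))]
  have hmap := measurableEmbedding_units_val.map_comap (selfDualMeasure ψ)
  rw [range_units_val] at hmap
  constructor
  · rw [mulMeasure, integrable_withDensity_iff_integrable_smul' hmeas htop]
    simp only [hreal]
    refine (measurableEmbedding_units_val.integrable_map_iff
      (g := fun x : F => (‖x‖⁻¹ : ℝ) • h x)).1 ?_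
    rw [hmap]
    exact hh
  · rw [mulMeasure, integral_withDensity_eq_integral_toReal_smul hmeas htop]
    simp only [hreal]
    rw [← measurableEmbedding_units_val.integral_map (g := fun x : F => (‖x‖⁻¹ : ℝ) • h x), hmap]

variable {ϖ : Fˣ} [IsUltrametricDist F] [ProperSpace F]

lemma mem_valuationClass_iff (hϖ : IsUniformizer ϖ) {n : ℕ} {k m : ℤ} {x : Fˣ}
    (hx : (x : F) ∈ shell ϖ m) : x ∈ valuationClass ϖ n k ↔ m ≡ k [ZMOD n] := by
  constructor
  · rintro ⟨u, l, hu, hl, rfl⟩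
    have : ((u * ϖ ^ l : Fˣ) : F) ∈ shell ϖ (0 + l) := by
      rw [Units.val_mul]
      exact mul_mem_shell (by rw [mem_shell, hu, zpow_zero]) (zpow_mem_shell l)
    rw [shell_unique hϖ hx this, zero_add]
    exact hl
  · intro h
    refine ⟨x * (ϖ ^ m)⁻¹, m, ?_, h, by simp⟩
    have := mul_mem_shell hx (inv_mem_shell (zpow_mem_shell (ϖ := ϖ) m))
    rw [mem_shell] at this
    simpa using this

/-- Asking only for boundedness of `f` lets one estimate serve Schwartz functions and `ψ` alike. -/
lemma exists_norm_mellinCoeff_le (χ : Fˣ →ₜ* ℂˣ) (hϖ : IsUniformizer ϖ)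
    (hnorm : ‖(ϖ : F)‖ = (residueCard F : ℝ)⁻¹) (μ : Measure F) [μ.IsAddHaarMeasure] {f : F → ℂ}
    {C : ℝ} (hf : ∀ x, ‖f x‖ ≤ C) :
    ∃ K : ℝ, ∀ m : ℤ, ((‖(ϖ : F)‖) ^ m)⁻¹ * ∫ x in shell ϖ m, ‖extChar χ x * f x‖ ∂μ
      ≤ K * ‖((χ ϖ : ℂˣ) : ℂ)‖ ^ m := by
  obtain ⟨B, hB, hχ⟩ := exists_norm_extChar_le χ ϖ
  have hC : 0 ≤ C := (norm_nonneg _).trans (hf 0)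
  refine ⟨B * C * ((1 - ‖(ϖ : F)‖) * μ.real (Metric.closedBall 0 1)), fun m => ?_⟩
  have hr := zpow_pos (norm_pos_of_unit ϖ) m
  rw [inv_mul_le_iff₀ hr]
  have h1 : ∀ x ∈ shell ϖ m, ‖‖extChar χ x * f x‖‖ ≤ B * ‖((χ ϖ : ℂˣ) : ℂ)‖ ^ m * C := by
    intro x hx
    rw [norm_norm, norm_mul]
    exact mul_le_mul (hχ m x hx) (hf x) (norm_nonneg _) (by positivity)
  have h2 := norm_setIntegral_le_of_norm_le_const (μ := μ) (isCompact_shell m).measure_lt_top h1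
  rw [measureReal_shell hϖ hnorm] at h2
  refine ((le_abs_self _).trans h2).trans (le_of_eq ?_)
  ring

/-- The Mellin integral of the cut-off of a Schwartz function converges in a half-plane, and is
the sum of the series formed by the coefficients. -/
lemma hasSum_mellin (hϖ : IsUniformizer ϖ)
    (hnorm : ‖(ϖ : F)‖ = (residueCard F : ℝ)⁻¹) {ψ : AddChar F Circle} (χ : Fˣ →ₜ* ℂˣ)
    [(selfDualMeasure ψ).IsAddHaarMeasure]
    {φ : F → ℂ} (hφ : IsSchwartzBruhat φ) (n : ℕ) (k : ℤ) {s : ℂ}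
    (hs : ‖((χ ϖ : ℂˣ) : ℂ) * (‖(ϖ : F)‖ : ℂ) ^ s‖ < 1) :
    Integrable (mellinIntegrand χ (cutoff ϖ n k φ) s) (mulMeasure ψ) ∧
      HasSum (fun m : ℤ => if m ≡ k [ZMOD n] then
          mellinCoeff ϖ (selfDualMeasure ψ) χ φ m * ((‖(ϖ : F)‖ : ℂ) ^ s) ^ m else 0)
        (∫ x, mellinIntegrand χ (cutoff ϖ n k φ) s x ∂(mulMeasure ψ)) := by
  set μ := selfDualMeasure ψ with hμ
  classical
  have hr := norm_pos_of_unit ϖ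
  set Q := (‖(ϖ : F)‖ : ℂ) ^ s with hQ
  have hQ0 : Q ≠ 0 := norm_uniformizer_cpow_ne_zero ϖ s
  set w := ((χ ϖ : ℂˣ) : ℂ) with hw
  have hw0 : w ≠ 0 := Units.ne_zero _
  let h : F → ℂ := fun x => if hx : x = 0 then 0 else
    mellinIntegrand χ (cutoff ϖ n k φ) s (Units.mk0 x hx)
  have hu : ∀ u : Fˣ, h u = mellinIntegrand χ (cutoff ϖ n k φ) s u := fun u => by
    simp only [h, dif_neg u.ne_zero, Units.mk0_val]
  have hshell : ∀ (m : ℤ) (x : F), x ∈ shell ϖ m → (‖x‖⁻¹ : ℝ) • h x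
      = (if m ≡ k [ZMOD n] then ((‖(ϖ : F)‖ : ℂ) ^ m)⁻¹ * Q ^ m else 0)
        * (extChar χ x * φ x) := by
    intro m x hx
    have hx0 := ne_zero_of_mem_shell hx
    have hcl := mem_valuationClass_iff hϖ (n := n) (k := k) (x := Units.mk0 x hx0) hx
    simp only [h, dif_neg hx0, mellinIntegrand, cutoff, Units.val_mk0]
    rw [mem_shell.1 hx, norm_zpow_cpow, Complex.real_smul, ← hQ, ← extChar_coe, Units.val_mk0]
    push_cast
    by_cases hm : m ≡ k [ZMOD n]
    · rw [if_pos hm, Set.indicator_of_mem (hcl.2 hm), Units.val_mk0]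
      ring
    · rw [if_neg hm, Set.indicator_of_notMem (fun h => hm (hcl.1 h))]
      ring
  obtain ⟨C, hC0, hC⟩ := hφ.exists_norm_le
  obtain ⟨K, hK⟩ := exists_norm_mellinCoeff_le χ hϖ hnorm μ hC
  obtain ⟨N, M, h1, h2⟩ := hφ.exists_bounds hϖ
  have hint : ∀ m : ℤ, IntegrableOn (fun x => (‖x‖⁻¹ : ℝ) • h x) (shell ϖ m) μ := by
    intro m
    rw [integrableOn_congr_fun (hshell m) (measurableSet_shell m)]
    refine ContinuousOn.integrableOn_compact (isCompact_shell m) ?_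
    exact continuousOn_const.mul ((continuousOn_extChar_shell χ m).mul hφ.continuous.continuousOn)
  have hnormint : ∀ m : ℤ, ∫ x in shell ϖ m, ‖(‖x‖⁻¹ : ℝ) • h x‖ ∂μ
      = (if m ≡ k [ZMOD n] then (‖(ϖ : F)‖ ^ m)⁻¹ * ‖Q‖ ^ m else 0)
        * ∫ x in shell ϖ m, ‖extChar χ x * φ x‖ ∂μ := by
    intro m
    rw [← integral_const_mul]
    refine setIntegral_congr_fun (measurableSet_shell m) fun x hx => ?_
    simp only [hshell m x hx]
    rw [norm_mul]
    congr 1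
    split_ifs <;> simp
  -- Compact support kills the shells with `m < M`, and the rest decays like `‖w * Q‖ ^ m`. This
  -- gives integrability on the union of the shells, hence the series.
  have hsummable : Summable fun m : ℤ => ∫ x in shell ϖ m, ‖(‖x‖⁻¹ : ℝ) • h x‖ ∂μ := by
    refine summable_of_norm_le_geometric (M := M) (K := K) (ρ := ‖w * Q‖)
      (norm_pos_iff.2 (mul_ne_zero hw0 hQ0)) hs ?_ ?_
    · intro m hm
      rw [hnormint, setIntegral_congr_fun (g := fun _ => (0 : ℝ)) (measurableSet_shell m)]
      · simp
      · intro x hx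
        simp only
        rw [h2 x (by rwa [mem_shell.1 hx, zpow_uniformizer_lt_iff hϖ]), mul_zero, norm_zero]
    · intro m
      rw [Real.norm_of_nonneg (integral_nonneg fun _ => norm_nonneg _), hnormint, norm_mul,
        mul_zpow]
      have h3 := hK m
      have h4 : 0 ≤ ‖Q‖ ^ m := zpow_nonneg (norm_nonneg _) m
      have h5 := mul_le_mul_of_nonneg_right h3 h4
      have h6 : 0 ≤ ((‖(ϖ : F)‖) ^ m)⁻¹ * ∫ x in shell ϖ m, ‖extChar χ x * φ x‖ ∂μ :=
        mul_nonneg (inv_nonneg.2 (zpow_pos hr m).le) (integral_nonneg fun _ => norm_nonneg _)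
      split_ifs
      · linarith
      · have := mul_nonneg h6 h4
        linarith
  have hintU := integrableOn_iUnion_of_summable_integral_norm hint hsummable
  have hsum := hasSum_integral_iUnion (fun m => measurableSet_shell m)
    (pairwise_disjoint_shell hϖ) hintU
  rw [iUnion_shell hϖ] at hintU hsum
  obtain ⟨hI1, hI2⟩ := integral_mulMeasure ψ hintU
  simp only [hu] at hI1 hI2
  refine ⟨hI1, ?_⟩
  rw [hI2]
  refine hsum.congr_fun fun m => ?_
  rw [setIntegral_congr_fun (measurableSet_shell m) (hshell m), integral_const_mul, mellinCoeff]
  split_ifs <;> ring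

end Mellin

/-! ### Identities of meromorphic functions off a discrete set. -/

section Meromorphic

open Topology

/-- The identity theorem for meromorphic functions on `ℂ`. -/
lemma eventuallyEq_codiscrete_of_eqOn {f g : ℂ → ℂ} (hf : MeromorphicOn f Set.univ)
    (hg : MeromorphicOn g Set.univ) {U : Set ℂ} (hU : IsOpen U) (hne : U.Nonempty)
    (h : ∀ s ∈ U, f s = g s) : f =ᶠ[codiscrete ℂ] g := by
  obtain ⟨x, hx⟩ := hne
  have hsub : MeromorphicOn (f - g) Set.univ := hf.sub hg
  -- Finite order at one point would propagate by connectedness to `x`, where the difference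
  -- vanishes identically nearby.
  have htop : ∀ y, meromorphicOrderAt (f - g) y = ⊤ := by
    intro y
    by_contra hy
    have h1 := hsub.meromorphicOrderAt_ne_top_of_isPreconnected isPreconnected_univ
      (Set.mem_univ y) (Set.mem_univ x) hy
    refine h1 (meromorphicOrderAt_eq_top_iff.2 ?_)
    filter_upwards [mem_nhdsWithin_of_mem_nhds (hU.mem_nhds hx)] with s hs
    rw [Pi.sub_apply, h s hs, sub_self]
  refine (mem_codiscrete (X := ℂ)).2 fun y => ?_
  rw [disjoint_principal_right, compl_compl]
  filter_upwards [meromorphicOrderAt_eq_top_iff.1 (htop y)] with s hs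
  exact sub_eq_zero.1 hs

/-- The identity theorem is applied to `f * f⁻¹` and `1`; since `0⁻¹ = 0`, the product is `0` at a
zero of `f`. -/
lemma eventually_codiscrete_ne_zero {f : ℂ → ℂ} (hf : MeromorphicOn f Set.univ) {U : Set ℂ}
    (hU : IsOpen U) (hne : U.Nonempty) (h : ∀ s ∈ U, f s ≠ 0) :
    ∀ᶠ s in codiscrete ℂ, f s ≠ 0 := by
  have h1 : (fun s => f s * (f s)⁻¹) =ᶠ[codiscrete ℂ] fun _ => 1 :=
    eventuallyEq_codiscrete_of_eqOn (hf.mul hf.inv) (fun x _ => MeromorphicAt.const 1 x) hU hne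
      fun s hs => mul_inv_cancel₀ (h s hs)
  filter_upwards [h1] with s hs h0
  rw [h0, zero_mul] at hs
  exact zero_ne_one hs

lemma tendsto_one_sub_codiscrete :
    Tendsto (fun s : ℂ => 1 - s) (codiscrete ℂ) (codiscrete ℂ) := by
  intro S hS
  rw [mem_codiscrete] at hS
  rw [mem_map, mem_codiscrete]
  intro y
  have h1 := hS (1 - y)
  rw [disjoint_principal_right, compl_compl] at h1 ⊢
  have h2 : Tendsto (fun s : ℂ => 1 - s) (𝓝[≠] y) (𝓝[≠] (1 - y)) := by
    refine tendsto_nhdsWithin_iff.2 ⟨?_, ?_⟩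
    · exact ((continuous_const.sub continuous_id).tendsto y).mono_left nhdsWithin_le_nhds
    · filter_upwards [self_mem_nhdsWithin] with s hs h
      exact hs (sub_right_injective h)
  exact h2 h1

lemma meromorphicOn_comp_one_sub {f : ℂ → ℂ} (hf : MeromorphicOn f Set.univ) :
    MeromorphicOn (fun s => f (1 - s)) Set.univ := fun s _ =>
  (hf (1 - s) (Set.mem_univ _)).comp_analyticAt (analyticAt_const.sub analyticAt_id)

lemma eventuallyEq_toMeromorphicNFOn {f : ℂ → ℂ} (hf : MeromorphicOn f Set.univ) :
    toMeromorphicNFOn f Set.univ =ᶠ[codiscrete ℂ] f :=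
  (toMeromorphicNFOn_eqOn_codiscrete hf).symm

/-- Passing to normal form thus keeps the values in the half-plane of convergence, where they must
equal the integral. -/
lemma toMeromorphicNFOn_eq_of_analyticAt {f : ℂ → ℂ} (hf : MeromorphicOn f Set.univ) {s : ℂ}
    (hs : AnalyticAt ℂ f s) : toMeromorphicNFOn f Set.univ s = f s := by
  rw [toMeromorphicNFOn_eq_toMeromorphicNFAt hf (Set.mem_univ s),
    toMeromorphicNFAt_eq_self.2 hs.meromorphicNFAt]

end Meromorphic

/-! ### Meromorphic continuation and the functional equation with Gauss series. -/

section Continuation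

variable {F : Type*} [NontriviallyNormedField F] {ϖ : Fˣ}

lemma analyticAt_norm_uniformizer_cpow (ϖ : Fˣ) (s : ℂ) :
    AnalyticAt ℂ (fun s : ℂ => (‖(ϖ : F)‖ : ℂ) ^ s) s :=
  analyticAt_const.cpow analyticAt_id
    (Complex.ofReal_mem_slitPlane.2 (norm_pos_of_unit ϖ))

lemma norm_norm_uniformizer_cpow (ϖ : Fˣ) (s : ℂ) :
    ‖(‖(ϖ : F)‖ : ℂ) ^ s‖ = ‖(ϖ : F)‖ ^ s.re :=
  Complex.norm_cpow_eq_rpow_re_of_pos (norm_pos_of_unit ϖ) s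

lemma isOpen_norm_mul_cpow_lt (ϖ : Fˣ) (w : ℂ) (δ : ℝ) :
    IsOpen {s : ℂ | ‖w * (‖(ϖ : F)‖ : ℂ) ^ s‖ < δ} := by
  have : Continuous fun s : ℂ => (‖(ϖ : F)‖ : ℂ) ^ s :=
    continuous_iff_continuousAt.2 fun s => (analyticAt_norm_uniformizer_cpow ϖ s).continuousAt
  exact isOpen_lt (continuous_const.mul this).norm continuous_const

lemma exists_forall_re_lt_norm_mul_cpow_lt (hϖ : IsUniformizer ϖ) (w : ℂ) {δ : ℝ} (hδ : 0 < δ) :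
    ∃ a : ℝ, ∀ s : ℂ, a < s.re → ‖w * (‖(ϖ : F)‖ : ℂ) ^ s‖ < δ := by
  have hr := norm_pos_of_unit ϖ
  obtain ⟨m, hm⟩ := exists_zpow_uniformizer_lt hϖ (div_pos hδ (by positivity : 0 < ‖w‖ + 1))
  refine ⟨m, fun s hs => ?_⟩
  rw [norm_mul, norm_norm_uniformizer_cpow]
  have h1 : ‖(ϖ : F)‖ ^ s.re ≤ ‖(ϖ : F)‖ ^ m := by
    rw [← Real.rpow_natCast]
    exact Real.rpow_le_rpow_of_exponent_ge hr hϖ.1.le hs.le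
  rw [lt_div_iff₀ (by positivity)] at hm
  have h2 := pow_pos hr m
  calc ‖w‖ * ‖(ϖ : F)‖ ^ s.re ≤ ‖w‖ * ‖(ϖ : F)‖ ^ m := by gcongr
    _ < ‖(ϖ : F)‖ ^ m * (‖w‖ + 1) := by linarith
    _ < δ := hm

/-- `R` is a meromorphic function which, in its half-plane of convergence, is the sum of the series
`∑ a_m q^{-ms}` over `m ≡ k` modulo `n`. -/
def IsSeriesContinuation (ϖ : Fˣ) (w : ℂ) (n : ℕ) (k : ℤ) (a : ℤ → ℂ) (R : ℂ → ℂ) : Prop :=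
  MeromorphicOn R Set.univ ∧ ∀ s : ℂ, ‖w * (‖(ϖ : F)‖ : ℂ) ^ s‖ < 1 → AnalyticAt ℂ R s ∧
    HasSum (fun m : ℤ => if m ≡ k [ZMOD n] then a m * ((‖(ϖ : F)‖ : ℂ) ^ s) ^ m else 0) (R s)

lemma isSeriesContinuation_ratSeries {n : ℕ} (hn : 1 ≤ n) (k : ℤ) {M N : ℤ}
    {a : ℤ → ℂ} {C w : ℂ} (ha : ∀ m < M, a m = 0) (haN : ∀ m, N ≤ m → a m = C * w ^ m)
    (hw : w ≠ 0) :
    IsSeriesContinuation ϖ w n k a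
      (fun s => ratSeries n k M N a C w ((‖(ϖ : F)‖ : ℂ) ^ s)) := by
  have hQ : ∀ s, AnalyticAt ℂ (fun s : ℂ => (‖(ϖ : F)‖ : ℂ) ^ s) s :=
    analyticAt_norm_uniformizer_cpow ϖ
  have hQ0 : ∀ s : ℂ, (‖(ϖ : F)‖ : ℂ) ^ s ≠ 0 := norm_uniformizer_cpow_ne_zero ϖ
  have h1 : ∀ s, AnalyticAt ℂ (fun s : ℂ => ∑ m ∈ Finset.Ico M N,
      (if m ≡ k [ZMOD n] then a m * ((‖(ϖ : F)‖ : ℂ) ^ s) ^ m else 0)) s := fun s => by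
    refine Finset.analyticAt_fun_sum _ fun m _ => ?_
    split_ifs
    · exact analyticAt_const.mul ((hQ s).zpow (hQ0 s))
    · exact analyticAt_const
  have h2 : ∀ s, AnalyticAt ℂ (fun s : ℂ => (w * (‖(ϖ : F)‖ : ℂ) ^ s) ^ (N + (k - N) % n)) s :=
    fun s => (analyticAt_const.mul (hQ s)).zpow (mul_ne_zero hw (hQ0 s))
  have h3 : ∀ s, AnalyticAt ℂ (fun s : ℂ => 1 - (w * (‖(ϖ : F)‖ : ℂ) ^ s) ^ n) s :=
    fun s => analyticAt_const.sub ((analyticAt_const.mul (hQ s)).pow n)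
  refine ⟨fun s _ => ?_, fun s hs => ⟨?_, hasSum_ratSeries hn k ha haN hw (hQ0 s) hs⟩⟩
  · exact (h1 s).meromorphicAt.add ((MeromorphicAt.const C s).mul
      ((h2 s).meromorphicAt.mul (h3 s).meromorphicAt.inv))
  · refine (h1 s).add (analyticAt_const.mul ((h2 s).mul ((h3 s).inv ?_)))
    intro h
    have h4 := congrArg norm (sub_eq_zero.1 h)
    rw [norm_one, norm_pow] at h4
    exact (pow_lt_one₀ (norm_nonneg _) hs (by omega : n ≠ 0)).ne h4.symm

lemma IsSeriesContinuation.const_mul {w : ℂ} {n : ℕ} {k : ℤ} {a : ℤ → ℂ} {R : ℂ → ℂ}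
    (h : IsSeriesContinuation ϖ w n k a R) (c : ℂ) :
    IsSeriesContinuation ϖ w n k (fun m => c * a m) (fun s => c * R s) := by
  refine ⟨fun s _ => (MeromorphicAt.const c s).mul (h.1 s (Set.mem_univ s)), fun s hs => ?_⟩
  obtain ⟨h1, h2⟩ := h.2 s hs
  refine ⟨analyticAt_const.mul h1, ?_⟩
  refine (h2.mul_left c).congr_fun fun m => ?_
  split_ifs <;> ring

/-- A series with a single non-zero term. -/
lemma isSeriesContinuation_single (w : ℂ) (n : ℕ) (k e : ℤ) {a : ℤ → ℂ}
    (ha : ∀ m, m ≠ e → a m = 0) :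
    IsSeriesContinuation ϖ w n k a
      (fun s => if e ≡ k [ZMOD n] then a e * ((‖(ϖ : F)‖ : ℂ) ^ s) ^ e else 0) := by
  have h1 : ∀ s, AnalyticAt ℂ (fun s : ℂ =>
      if e ≡ k [ZMOD n] then a e * ((‖(ϖ : F)‖ : ℂ) ^ s) ^ e else 0) s := fun s => by
    split_ifs
    · exact analyticAt_const.mul
        ((analyticAt_norm_uniformizer_cpow ϖ s).zpow (norm_uniformizer_cpow_ne_zero ϖ s))
    · exact analyticAt_const
  refine ⟨fun s _ => (h1 s).meromorphicAt, fun s _ => ⟨h1 s, ?_⟩⟩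
  refine hasSum_single (f := fun m : ℤ =>
    if m ≡ k [ZMOD n] then a m * ((‖(ϖ : F)‖ : ℂ) ^ s) ^ m else 0) e fun m hm => ?_
  simp only [ha m hm, zero_mul, ite_self]

variable [MeasurableSpace F] [BorelSpace F] [IsUltrametricDist F] [ProperSpace F]

lemma exists_isSeriesContinuation (hϖ : IsUniformizer ϖ)
    (hnorm : ‖(ϖ : F)‖ = (residueCard F : ℝ)⁻¹) (χ : Fˣ →ₜ* ℂˣ) (μ : Measure F)
    [μ.IsAddHaarMeasure] {φ : F → ℂ} (hφ : IsSchwartzBruhat φ) {n : ℕ} (hn : 1 ≤ n) (k : ℤ) :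
    ∃ R, IsSeriesContinuation ϖ ((χ ϖ : ℂˣ) : ℂ) n k (mellinCoeff ϖ μ χ φ) R := by
  obtain ⟨M, N, C, h1, h2⟩ := exists_mellinCoeff_eq χ hϖ hnorm μ hφ
  exact ⟨_, isSeriesContinuation_ratSeries hn k h1 h2 (Units.ne_zero _)⟩

variable {ψ : AddChar F Circle}

lemma isMellinContinuation_toMeromorphicNFOn (hϖ : IsUniformizer ϖ)
    (hnorm : ‖(ϖ : F)‖ = (residueCard F : ℝ)⁻¹) {χ : Fˣ →ₜ* ℂˣ}
    [(selfDualMeasure ψ).IsAddHaarMeasure] {φ : F → ℂ} (hφ : IsSchwartzBruhat φ) {n : ℕ} {k : ℤ}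
    {R : ℂ → ℂ} (hR : IsSeriesContinuation ϖ ((χ ϖ : ℂˣ) : ℂ) n k
      (mellinCoeff ϖ (selfDualMeasure ψ) χ φ) R) :
    IsMellinContinuation ψ χ (cutoff ϖ n k φ) (toMeromorphicNFOn R Set.univ) := by
  refine ⟨meromorphicNFOn_toMeromorphicNFOn R Set.univ, ?_⟩
  obtain ⟨a, ha⟩ := exists_forall_re_lt_norm_mul_cpow_lt hϖ ((χ ϖ : ℂˣ) : ℂ) one_pos
  refine ⟨a, fun s hs => ?_⟩
  obtain ⟨h1, h2⟩ := hasSum_mellin hϖ hnorm (ψ := ψ) χ hφ n k (ha s hs)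
  obtain ⟨h3, h4⟩ := hR.2 s (ha s hs)
  exact ⟨h1, (toMeromorphicNFOn_eq_of_analyticAt hR.1 h3).trans (h4.unique h2)⟩

lemma isOpen_lt_re (a : ℝ) : IsOpen {s : ℂ | a < s.re} :=
  isOpen_lt continuous_const Complex.continuous_re

/-- The continuation inside `zeta` is an arbitrary choice, but it and `R` both equal the Mellin
integral on a common half-plane, so the identity theorem applies. -/
lemma zeta_eventuallyEq (hϖ : IsUniformizer ϖ)
    (hnorm : ‖(ϖ : F)‖ = (residueCard F : ℝ)⁻¹) {χ : Fˣ →ₜ* ℂˣ}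
    [(selfDualMeasure ψ).IsAddHaarMeasure] {φ : F → ℂ} (hφ : IsSchwartzBruhat φ) {n : ℕ} {k : ℤ}
    {R : ℂ → ℂ} (hR : IsSeriesContinuation ϖ ((χ ϖ : ℂˣ) : ℂ) n k
      (mellinCoeff ϖ (selfDualMeasure ψ) χ φ) R) :
    (fun s => zeta ψ s χ (cutoff ϖ n k φ)) =ᶠ[codiscrete ℂ] R := by
  have hex : ∃ Z : ℂ → ℂ, IsMellinContinuation ψ χ (cutoff ϖ n k φ) Z :=
    ⟨_, isMellinContinuation_toMeromorphicNFOn hϖ hnorm hφ hR⟩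
  have hz : (fun s => zeta ψ s χ (cutoff ϖ n k φ)) = hex.choose := by
    ext s
    rw [zeta, dif_pos hex]
  rw [hz]
  obtain ⟨hm, a, ha⟩ := hex.choose_spec
  obtain ⟨a', ha'⟩ := exists_forall_re_lt_norm_mul_cpow_lt hϖ ((χ ϖ : ℂˣ) : ℂ) one_pos
  refine eventuallyEq_codiscrete_of_eqOn hm.meromorphicOn hR.1 (isOpen_lt_re (max a a'))
    ⟨((max a a' + 1 : ℝ) : ℂ), by
      rw [Set.mem_ofPred_eq, Complex.ofReal_re]; exact lt_add_one _⟩ fun s hs => ?_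
  rw [(ha s ((le_max_left _ _).trans_lt hs)).2]
  have h := ha' s ((le_max_right _ _).trans_lt hs)
  exact (hasSum_mellin hϖ hnorm χ hφ n k h).2.unique (hR.2 s h).2

lemma norm_uniformizer_cpow_one_sub (ϖ : Fˣ) (s : ℂ) :
    (‖(ϖ : F)‖ : ℂ) ^ (1 - s) = (‖(ϖ : F)‖ : ℂ) * ((‖(ϖ : F)‖ : ℂ) ^ s)⁻¹ := by
  rw [Complex.cpow_sub _ _ (by exact_mod_cast (norm_pos_of_unit ϖ).ne'), Complex.cpow_one,
    div_eq_mul_inv]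

/-- The half-planes of convergence for `(s, χ)` and `(1 - s, χ⁻¹)` meet. -/
lemma exists_mem_strip (hϖ : IsUniformizer ϖ) {w : ℂ} (hw : w ≠ 0) :
    ∃ s : ℂ, ‖w * (‖(ϖ : F)‖ : ℂ) ^ s‖ < 1 ∧ ‖w⁻¹ * (‖(ϖ : F)‖ : ℂ) ^ (1 - s)‖ < 1 := by
  have hr := norm_pos_of_unit ϖ
  have hw' : 0 < ‖w‖ := norm_pos_iff.2 hw
  set ρ := Real.sqrt ‖(ϖ : F)‖ with hρ
  have hρ0 : 0 < ρ := Real.sqrt_pos.2 hr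
  have hρ1 : ρ < 1 := by
    rw [hρ, Real.sqrt_lt' one_pos, one_pow]
    exact hϖ.1
  have hρ2 : ρ * ρ = ‖(ϖ : F)‖ := Real.mul_self_sqrt hr.le
  -- This `s` makes `‖w * ‖ϖ‖^s‖ = ρ`; the two norms multiply to `‖ϖ‖ = ρ²`, so the other is `ρ` as
  -- well.
  refine ⟨(Real.logb ‖(ϖ : F)‖ (ρ / ‖w‖) : ℝ), ?_⟩
  have h1 : ‖(‖(ϖ : F)‖ : ℂ) ^ ((Real.logb ‖(ϖ : F)‖ (ρ / ‖w‖) : ℝ) : ℂ)‖ = ρ / ‖w‖ := by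
    rw [norm_norm_uniformizer_cpow, Complex.ofReal_re,
      Real.rpow_logb hr hϖ.1.ne (div_pos hρ0 hw')]
  rw [norm_uniformizer_cpow_one_sub, norm_mul, norm_mul, norm_mul, norm_inv, norm_inv, h1,
    Complex.norm_real, norm_norm]
  constructor
  · rw [mul_div_cancel₀ _ hw'.ne']
    exact hρ1
  · have : ‖w‖⁻¹ * (‖(ϖ : F)‖ * (ρ / ‖w‖)⁻¹) = ρ := by
      rw [← hρ2]
      field_simp
    rw [this]
    exact hρ1

/-- The functional equation of the partial Mellin transforms, with the coefficients given as
partial sums of the generating series of the Gauss sums. -/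
lemma zeta_fourier_eventuallyEq_sum (hϖ : IsUniformizer ϖ)
    (hnorm : ‖(ϖ : F)‖ = (residueCard F : ℝ)⁻¹) (hψc : Continuous ψ) (hψ : ψ ≠ 1)
    {χ : Fˣ →ₜ* ℂˣ} [(selfDualMeasure ψ).IsAddHaarMeasure] {φ : F → ℂ} (hφ : IsSchwartzBruhat φ)
    {n : ℕ} (hn : 1 ≤ n) (k e : ℤ) {G : ℕ → ℂ → ℂ}
    (hG : ∀ j < n, IsSeriesContinuation ϖ ((χ ϖ : ℂˣ) : ℂ) n (j + e)
      (gaussCoeff ϖ (selfDualMeasure ψ) χ ψ) (G j))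
    (hgs : ∀ s : ℂ, ‖((χ ϖ : ℂˣ) : ℂ) * (‖(ϖ : F)‖ : ℂ) ^ s‖ < 1 → Summable fun j : ℤ =>
      ‖gaussCoeff ϖ (selfDualMeasure ψ) χ ψ j * ((‖(ϖ : F)‖ : ℂ) ^ s) ^ j‖) :
    (fun s => zeta ψ s χ (cutoff ϖ n k (fourier ψ φ))) =ᶠ[codiscrete ℂ]
      fun s => ∑ j ∈ Finset.range n, G j s * zeta ψ (1 - s) χ⁻¹ (cutoff ϖ n (j + e - k) φ) := by
  set μ := selfDualMeasure ψ with hμ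
  have hφ' : IsSchwartzBruhat (fourier ψ φ) := hφ.fourierWith hϖ hψc hψ μ
  have hχinv : (((χ⁻¹ : Fˣ →ₜ* ℂˣ) ϖ : ℂˣ) : ℂ) = ((χ ϖ : ℂˣ) : ℂ)⁻¹ :=
    Units.val_inv_eq_inv_val _
  obtain ⟨R, hR⟩ := exists_isSeriesContinuation hϖ hnorm χ μ hφ' hn k
  choose Z hZ using fun j : ℤ => exists_isSeriesContinuation hϖ hnorm χ⁻¹ μ hφ hn (j + e - k)
  have hmain : R =ᶠ[codiscrete ℂ] fun s => ∑ j ∈ Finset.range n, G j s * Z j (1 - s) := by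
    have hU : IsOpen ({s : ℂ | ‖((χ ϖ : ℂˣ) : ℂ) * (‖(ϖ : F)‖ : ℂ) ^ s‖ < 1} ∩
        {s : ℂ | ‖((χ ϖ : ℂˣ) : ℂ)⁻¹ * (‖(ϖ : F)‖ : ℂ) ^ (1 - s)‖ < 1}) :=
      (isOpen_norm_mul_cpow_lt ϖ _ 1).inter ((isOpen_norm_mul_cpow_lt ϖ _ 1).preimage
        (continuous_const.sub continuous_id))
    obtain ⟨s₀, hs₀⟩ := exists_mem_strip hϖ (Units.ne_zero (χ ϖ))
    refine eventuallyEq_codiscrete_of_eqOn hR.1 ?_ hU ⟨s₀, hs₀⟩ ?_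
    · intro s hs
      refine MeromorphicAt.fun_sum fun j hj => ?_
      exact ((hG j (Finset.mem_range.1 hj)).1 s hs).mul
        (meromorphicOn_comp_one_sub (hZ j).1 s hs)
    · rintro s ⟨hs1, hs2⟩
      simp only [Set.mem_ofPred_eq] at hs1 hs2
      rw [← hχinv] at hs2
      have hQ0 := norm_uniformizer_cpow_ne_zero ϖ s
      refine (hR.2 s hs1).2.unique ?_
      -- The weight `‖ϖ‖^l` in the convolution combines with `Q^(-l)` to `(‖ϖ‖^(1 - s))^l`: this is
      -- where `1 - s` comes from.
      have hcoef : ∀ l : ℤ, mellinCoeff ϖ μ χ⁻¹ φ l * ((‖(ϖ : F)‖ : ℂ) ^ (1 - s)) ^ l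
          = (‖(ϖ : F)‖ : ℂ) ^ l * mellinCoeff ϖ μ χ⁻¹ φ l * (((‖(ϖ : F)‖ : ℂ) ^ s) ^ l)⁻¹ := by
        intro l
        rw [norm_uniformizer_cpow_one_sub, mul_zpow, inv_zpow]
        ring
      refine hasSum_convolution_modEq hn k e hQ0
        (fun m => hasSum_mellinCoeff_fourierWith χ hϖ hnorm hψc μ hφ m) (hgs s hs1) ?_
        (fun j hj => ((hG j hj).2 s hs1).2) (fun j _ => ?_)
      · simp only [← hcoef]
        -- Modulus `1` imposes no congruence, so this is absolute convergence of the full series.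
        have h1 := (hasSum_mellin hϖ hnorm (ψ := ψ) χ⁻¹ hφ 1 0 hs2).2.summable.norm
        simpa [Int.modEq_one] using h1
      · simp only [← hcoef]
        exact ((hZ j).2 (1 - s) hs2).2
  have hZ' : ∀ᶠ s in codiscrete ℂ, ∀ j ∈ Finset.range n,
      zeta ψ (1 - s) χ⁻¹ (cutoff ϖ n (j + e - k) φ) = Z j (1 - s) := by
    rw [Filter.eventually_all_finset]
    exact fun j _ => tendsto_one_sub_codiscrete.eventually (zeta_eventuallyEq hϖ hnorm hφ (hZ j))
  filter_upwards [zeta_eventuallyEq hϖ hnorm hφ' hR, hmain, hZ'] with s h1 h2 h3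
  rw [h1, h2]
  exact Finset.sum_congr rfl fun j hj => by rw [h3 j hj]

end Continuation

/-! ### Tate's gamma and epsilon factors, and the coefficients `θ_m`. -/

section FunctionalEquation

variable {F : Type*} [NontriviallyNormedField F] {ϖ : Fˣ}
  [MeasurableSpace F] [BorelSpace F] [IsUltrametricDist F] [ProperSpace F]
  {ψ : AddChar F Circle} {χ : Fˣ →ₜ* ℂˣ}

lemma summable_gaussCoeff (hϖ : IsUniformizer ϖ)
    (hnorm : ‖(ϖ : F)‖ = (residueCard F : ℝ)⁻¹) (hψc : Continuous ψ) (hψ : ψ ≠ 1)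
    (μ : Measure F) [μ.IsAddHaarMeasure] {s : ℂ}
    (hs : ‖((χ ϖ : ℂˣ) : ℂ) * (‖(ϖ : F)‖ : ℂ) ^ s‖ < 1) :
    Summable fun j : ℤ => ‖gaussCoeff ϖ μ χ ψ j * ((‖(ϖ : F)‖ : ℂ) ^ s) ^ j‖ := by
  obtain ⟨K, hK⟩ := exists_norm_mellinCoeff_le χ hϖ hnorm μ (f := fun x => (ψ x : ℂ)) (C := 1)
    fun x => (Circle.norm_coe _).le
  refine summable_of_norm_le_geometric (M := addConductor ϖ ψ - (mulConductor ϖ χ + 1 : ℕ))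
    (K := K) (norm_pos_iff.2 (mul_ne_zero (Units.ne_zero (χ ϖ))
      (norm_uniformizer_cpow_ne_zero ϖ s))) hs ?_ ?_
  · intro j hj
    -- One more than the conductor, so that `1 ≤ f` also for unramified `χ`.
    rw [gaussCoeff_eq_zero_of_lt χ hϖ hψc hψ μ (f := mulConductor ϖ χ + 1) (by omega)
      (fun u hu hu' => mulConductor_spec χ hϖ hu (hu'.trans ?_)) (by omega), zero_mul, norm_zero]
    exact pow_le_pow_of_le_one (norm_nonneg _) hϖ.1.le (Nat.le_succ _)
  · intro j
    rw [norm_norm, norm_mul, norm_mul, norm_zpow, mul_zpow, ← mul_assoc]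
    gcongr
    refine le_trans ?_ (hK j)
    rw [gaussCoeff, mellinCoeff, norm_mul, norm_inv, norm_zpow, Complex.norm_real, norm_norm]
    gcongr
    exact norm_integral_le_integral_norm _

lemma valuationClass_one (hϖ : IsUniformizer ϖ) (k : ℤ) :
    valuationClass ϖ 1 k = (Set.univ : Set Fˣ) := by
  ext x
  obtain ⟨m, hm⟩ := exists_mem_shell hϖ x.ne_zero
  simp [mem_valuationClass_iff hϖ hm, Int.modEq_one]

lemma cutoff_one (hϖ : IsUniformizer ϖ) (k : ℤ) (φ : F → ℂ) :
    cutoff ϖ 1 k φ = fun x : Fˣ => φ x := by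
  rw [cutoff, valuationClass_one hϖ, Set.indicator_univ]

lemma charNegOne_mul_self (χ : Fˣ →ₜ* ℂˣ) :
    ((χ (-1) : ℂˣ) : ℂ) * ((χ (-1) : ℂˣ) : ℂ) = 1 := by
  rw [← Units.val_mul, ← map_mul]
  simp

lemma inv_charNegOne (χ : Fˣ →ₜ* ℂˣ) : (((χ (-1) : ℂˣ) : ℂ))⁻¹ = ((χ (-1) : ℂˣ) : ℂ) :=
  inv_eq_of_mul_eq_one_left (charNegOne_mul_self χ)

lemma IsSchwartzBruhat.comp_neg {φ : F → ℂ} (hφ : IsSchwartzBruhat φ) :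
    IsSchwartzBruhat (fun x => φ (-x)) :=
  ⟨hφ.1.comp_continuous continuous_neg, hφ.2.comp_homeomorph (Homeomorph.neg F)⟩

lemma mellinCoeff_comp_neg (hϖ : IsUniformizer ϖ)
    (hnorm : ‖(ϖ : F)‖ = (residueCard F : ℝ)⁻¹) (μ : Measure F) [μ.IsAddHaarMeasure]
    (φ : F → ℂ) (m : ℤ) :
    mellinCoeff ϖ μ χ (fun x => φ (-x)) m = ((χ (-1) : ℂˣ) : ℂ) * mellinCoeff ϖ μ χ φ m := by
  have h1 : ((-1 : Fˣ) : F) ∈ shell ϖ 0 := by simp [mem_shell]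
  have h := mellinCoeff_comp_mul_left χ hϖ hnorm μ h1 φ m
  rw [extChar_coe, inv_charNegOne, add_zero] at h
  simpa using h

/-- There is a Schwartz function whose Mellin transform is a non-zero constant. -/
lemma exists_mellinCoeff_eq_single (hϖ : IsUniformizer ϖ)
    (χ : Fˣ →ₜ* ℂˣ) (μ : Measure F) [μ.IsAddHaarMeasure] :
    ∃ φ : F → ℂ, IsSchwartzBruhat φ ∧ mellinCoeff ϖ μ χ φ 0 ≠ 0 ∧
      ∀ m, m ≠ 0 → mellinCoeff ϖ μ χ φ m = 0 := by
  -- The extra `1` makes the radius `< 1`, so the ball around `1` lies in the unit shell even when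
  -- the conductor is `0`; `χ` is trivial on it.
  set f : ℕ := mulConductor ϖ χ + 1 with hf
  have hr := norm_pos_of_unit ϖ
  have hrf : 0 < ‖(ϖ : F)‖ ^ f := pow_pos hr f
  have hrf1 : ‖(ϖ : F)‖ ^ f < 1 := pow_lt_one₀ hr.le hϖ.1 (by omega)
  set B : Set F := Metric.closedBall 1 (‖(ϖ : F)‖ ^ f) with hB
  have hBm : MeasurableSet B := Metric.isClosed_closedBall.measurableSet
  have hshell : ∀ x ∈ B, x ∈ shell ϖ 0 := fun x hx => by
    rw [hB, Metric.mem_closedBall, dist_eq_norm] at hx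
    have : ‖(1 : F) + (x - 1)‖ = ‖(1 : F)‖ :=
      norm_add_eq_of_lt (by rw [norm_one]; exact hx.trans_lt hrf1)
    rw [mem_shell, zpow_zero, ← norm_one (α := F), ← this, add_sub_cancel]
  have hχ : ∀ x ∈ B, extChar χ x = 1 := fun x hx => by
    have h1 := hshell x hx
    rw [extChar_of_ne_zero χ (ne_zero_of_mem_shell h1), mulConductor_spec χ hϖ, Units.val_one]
    · rw [Units.val_mk0, mem_shell.1 h1, zpow_zero]
    · rw [Units.val_mk0, ← dist_eq_norm]
      exact (Metric.mem_closedBall.1 hx).trans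
        (pow_le_pow_of_le_one hr.le hϖ.1.le (Nat.le_succ _))
  refine ⟨B.indicator fun _ => 1, ⟨?_, ?_⟩, ?_, ?_⟩
  · exact ((LocallyConstant.const F (1 : ℂ)).indicator (U := B)
      ⟨Metric.isClosed_closedBall, IsUltrametricDist.isOpen_closedBall _ hrf.ne'⟩).isLocallyConstant
  · refine HasCompactSupport.intro (isCompact_closedBall (1 : F) (‖(ϖ : F)‖ ^ f)) fun x hx => ?_
    exact Set.indicator_of_notMem hx _
  · have h1 : ∫ x in shell ϖ 0, extChar χ x * B.indicator (fun _ => (1 : ℂ)) x ∂μ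
        = (μ.real B : ℂ) := by
      have : ∀ x, extChar χ x * B.indicator (fun _ => (1 : ℂ)) x
          = B.indicator (fun _ => (1 : ℂ)) x := fun x => by
        by_cases hx : x ∈ B
        · rw [hχ x hx, one_mul]
        · rw [Set.indicator_of_notMem hx, mul_zero]
      simp only [this]
      rw [setIntegral_indicator hBm, Set.inter_eq_right.2 hshell, setIntegral_const,
        Complex.real_smul, mul_one]
    rw [mellinCoeff, h1, zpow_zero, inv_one, one_mul]
    have : 0 < μ.real B := ENNReal.toReal_pos (Metric.measure_closedBall_pos μ 1 hrf).ne'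
      (isCompact_closedBall _ _).measure_ne_top
    exact_mod_cast this.ne'
  · intro m hm
    rw [mellinCoeff_congr χ μ (g := fun _ => 0), mellinCoeff_zero]
    exact fun x hx => Set.indicator_of_notMem (fun hxB => hm (shell_unique hϖ hx (hshell x hxB))) _

/-- Tate's functional equation: `γ(s, χ, ψ) = χ(-1) / G(s)`, where `G` is the generating series of
the Gauss sums. -/
lemma tateGamma_eventuallyEq (hϖ : IsUniformizer ϖ)
    (hnorm : ‖(ϖ : F)‖ = (residueCard F : ℝ)⁻¹) (hψc : Continuous ψ) (hψ : ψ ≠ 1)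
    {k : ℤ} {G : ℂ → ℂ} (hG : IsSeriesContinuation ϖ ((χ ϖ : ℂˣ) : ℂ) 1 k
      (gaussCoeff ϖ (selfDualMeasure ψ) χ ψ) G) :
    MeromorphicOn (fun s => tateGamma s χ ψ) Set.univ ∧
      ∀ᶠ s in codiscrete ℂ, G s ≠ 0 ∧ tateGamma s χ ψ = ((χ (-1) : ℂˣ) : ℂ) * (G s)⁻¹ := by
  have hsd := isSelfDual_selfDualMeasure hϖ hnorm hψc hψ
  have : (selfDualMeasure ψ).IsAddHaarMeasure := hsd.1
  set c : ℂ := ((χ (-1) : ℂˣ) : ℂ) with hc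
  have hcc : c * c = 1 := charNegOne_mul_self χ
  have hFE : ∀ φ : F → ℂ, IsSchwartzBruhat φ →
      (fun s => c * zeta ψ s χ (fun x => φ x)) =ᶠ[codiscrete ℂ]
        fun s => G s * zeta ψ (1 - s) χ⁻¹ (fun x => fourier ψ φ x) := by
    intro φ hφ
    have hφ' : IsSchwartzBruhat (fourier ψ φ) := hφ.fourierWith hϖ hψc hψ _
    -- The equation modulo `1` is applied to `φ̂` rather than `φ`: inversion turns the double
    -- transform into `φ (-x)`, whose zeta function is `χ(-1)` times that of `φ`.
    have h1 := zeta_fourier_eventuallyEq_sum hϖ hnorm hψc hψ (χ := χ) hφ' le_rfl 0 k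
      (G := fun _ => G) (fun j hj => by
        rw [Nat.lt_one_iff.1 hj, Nat.cast_zero, zero_add]
        exact hG) (fun s hs => summable_gaussCoeff hϖ hnorm hψc hψ _ hs)
    have hinv : fourier ψ (fourier ψ φ) = fun x => φ (-x) := funext fun x => hsd.2 φ hφ x
    rw [hinv] at h1
    obtain ⟨R, hR⟩ := exists_isSeriesContinuation hϖ hnorm χ (selfDualMeasure ψ) hφ le_rfl 0
    have hR' : IsSeriesContinuation ϖ ((χ ϖ : ℂˣ) : ℂ) 1 0
        (mellinCoeff ϖ (selfDualMeasure ψ) χ (fun x => φ (-x))) (fun s => c * R s) := by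
      have := hR.const_mul c
      simpa only [hc, ← mellinCoeff_comp_neg hϖ hnorm] using this
    filter_upwards [h1, zeta_eventuallyEq hϖ hnorm hφ hR,
      zeta_eventuallyEq hϖ hnorm hφ.comp_neg hR'] with s h2 h3 h4
    rw [h4, ← h3, Finset.sum_range_one, cutoff_one hϖ, cutoff_one hϖ] at h2
    exact h2
  obtain ⟨φ₀, hφ₀, hne, hz⟩ := exists_mellinCoeff_eq_single hϖ χ (selfDualMeasure ψ)
  have hzeta : (fun s => zeta ψ s χ (fun x => φ₀ x)) =ᶠ[codiscrete ℂ]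
      fun _ => mellinCoeff ϖ (selfDualMeasure ψ) χ φ₀ 0 := by
    have := zeta_eventuallyEq hϖ hnorm hφ₀
      (isSeriesContinuation_single (ϖ := ϖ) ((χ ϖ : ℂˣ) : ℂ) 1 0 0 hz)
    rw [cutoff_one hϖ] at this
    simpa [Int.modEq_one] using this
  have hc0 : c ≠ 0 := Units.ne_zero _
  -- A zero of `G` would make the left side for `φ₀` vanish, but that side is a nonzero constant.
  have hG0 : ∀ᶠ s in codiscrete ℂ, G s ≠ 0 := by
    filter_upwards [hFE φ₀ hφ₀, hzeta] with s h1 h2 h3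
    rw [h2, h3, zero_mul] at h1
    exact mul_ne_zero hc0 hne h1
  have hmer : MeromorphicOn (fun s => c * (G s)⁻¹) Set.univ := fun s hs =>
    (MeromorphicAt.const c s).mul (hG.1 s hs).inv
  have hex : ∃ g : ℂ → ℂ, IsTateGamma ψ χ g := by
    refine ⟨toMeromorphicNFOn (fun s => c * (G s)⁻¹) Set.univ,
      meromorphicNFOn_toMeromorphicNFOn _ _, fun φ hφ => ?_⟩
    filter_upwards [hFE φ hφ, hG0, eventuallyEq_toMeromorphicNFOn hmer] with s h1 h2 h3
    rw [h3]
    field_simp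
    linear_combination -h1
  have hγ : (fun s => tateGamma s χ ψ) = hex.choose := by
    ext s
    rw [tateGamma, dif_pos hex]
  have hspec := hex.choose_spec
  rw [← hγ] at hspec
  refine ⟨hspec.1.meromorphicOn, ?_⟩
  filter_upwards [hFE φ₀ hφ₀, hzeta, hG0, hspec.2 φ₀ hφ₀] with s h1 h2 h3 h4
  refine ⟨h3, ?_⟩
  rw [h4, h2, ← mul_assoc] at h1
  have h5 := mul_right_cancel₀ hne h1
  rw [h5]
  field_simp

lemma residueCard_cpow_neg (hnorm : ‖(ϖ : F)‖ = (residueCard F : ℝ)⁻¹) (s : ℂ) :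
    (residueCard F : ℂ) ^ (-s) = (‖(ϖ : F)‖ : ℂ) ^ s := by
  have h : (residueCard F : ℂ) = (‖(ϖ : F)‖ : ℂ)⁻¹ := by rw [hnorm]; simp
  rw [h, Complex.inv_cpow, Complex.cpow_neg, inv_inv]
  rw [Complex.arg_ofReal_of_nonneg (norm_nonneg _)]
  exact Real.pi_pos.ne

lemma LFactor_of_unramified (hnorm : ‖(ϖ : F)‖ = (residueCard F : ℝ)⁻¹) (hχ : IsUnramified χ)
    (s : ℂ) :
    LFactor ϖ s χ = (1 - ((χ ϖ : ℂˣ) : ℂ) * (‖(ϖ : F)‖ : ℂ) ^ s)⁻¹ := by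
  rw [LFactor, if_pos hχ, residueCard_cpow_neg hnorm]

lemma meromorphicOn_LFactor (hnorm : ‖(ϖ : F)‖ = (residueCard F : ℝ)⁻¹) (χ : Fˣ →ₜ* ℂˣ) :
    MeromorphicOn (fun s => LFactor ϖ s χ) Set.univ := by
  intro s _
  by_cases hχ : IsUnramified χ
  · simp only [LFactor_of_unramified hnorm hχ]
    exact ((MeromorphicAt.const 1 s).sub ((MeromorphicAt.const _ s).mul
      (analyticAt_norm_uniformizer_cpow ϖ s).meromorphicAt)).inv
  · simp only [LFactor, if_neg hχ]
    exact MeromorphicAt.const 1 s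

lemma IsUnramified.inv (hχ : IsUnramified χ) : IsUnramified χ⁻¹ := fun u hu => by
  change (χ u)⁻¹ = 1
  rw [hχ u hu, inv_one]

lemma isUnramified_inv_iff : IsUnramified χ⁻¹ ↔ IsUnramified χ :=
  ⟨fun h u hu => inv_eq_one.1 (h u hu), IsUnramified.inv⟩

lemma IsUnramified.pow (hχ : IsUnramified χ) (n : ℕ) : IsUnramified (χ ^ n) := fun u hu => by
  rw [ContinuousMonoidHom.pow_apply, hχ u hu, one_pow]

lemma epsilon_eventuallyEq (hϖ : IsUniformizer ϖ)
    (hnorm : ‖(ϖ : F)‖ = (residueCard F : ℝ)⁻¹) (hψc : Continuous ψ) (hψ : ψ ≠ 1)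
    {k : ℤ} {G : ℂ → ℂ} (hG : IsSeriesContinuation ϖ ((χ ϖ : ℂˣ) : ℂ) 1 k
      (gaussCoeff ϖ (selfDualMeasure ψ) χ ψ) G) :
    (fun s => (epsilon ϖ s χ ψ)⁻¹) =ᶠ[codiscrete ℂ] fun s =>
      ((χ (-1) : ℂˣ) : ℂ) * G s * LFactor ϖ (1 - s) χ⁻¹ / LFactor ϖ s χ := by
  obtain ⟨hm, h⟩ := tateGamma_eventuallyEq hϖ hnorm hψc hψ hG
  have hmer : MeromorphicOn
      (fun z : ℂ => tateGamma z χ ψ * LFactor ϖ z χ / LFactor ϖ (1 - z) χ⁻¹) Set.univ :=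
    (hm.mul (meromorphicOn_LFactor hnorm χ)).div
      (meromorphicOn_comp_one_sub (meromorphicOn_LFactor hnorm χ⁻¹))
  filter_upwards [h, eventuallyEq_toMeromorphicNFOn hmer] with s h1 h2
  rw [epsilon, h2, h1.2, inv_div, div_eq_mul_inv, div_eq_mul_inv, mul_inv_rev, mul_inv_rev, inv_inv,
    inv_charNegOne]
  ring

/-- For ramified `χ`, the generating series of the Gauss sums has a single term. -/
lemma isSeriesContinuation_theta_of_ramified (hϖ : IsUniformizer ϖ)
    (hnorm : ‖(ϖ : F)‖ = (residueCard F : ℝ)⁻¹) (hψc : Continuous ψ) (hψ : ψ ≠ 1)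
    (hχ : ¬IsUnramified χ) {n : ℕ} :
    ∃ G : ℕ → ℂ → ℂ, (∀ j < n, IsSeriesContinuation ϖ ((χ ϖ : ℂˣ) : ℂ) n
        (j + relConductor ϖ ψ χ) (gaussCoeff ϖ (selfDualMeasure ψ) χ ψ) (G j)) ∧
      ∀ᶠ s in codiscrete ℂ, ∀ j ∈ Finset.range n, G j s = theta ϖ n j s χ ψ := by
  have : (selfDualMeasure ψ).IsAddHaarMeasure := (isSelfDual_selfDualMeasure hϖ hnorm hψc hψ).1
  set e := relConductor ϖ ψ χ with he
  have hz : ∀ m, m ≠ e → gaussCoeff ϖ (selfDualMeasure ψ) χ ψ m = 0 := fun m hm =>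
    gaussCoeff_eq_zero_of_ramified χ hϖ hnorm hψc hψ _ hχ hm
  refine ⟨_, fun j _ => isSeriesContinuation_single _ n (j + e) e hz, ?_⟩
  have h1 := epsilon_eventuallyEq hϖ hnorm hψc hψ (χ := χ)
    (isSeriesContinuation_single (ϖ := ϖ) ((χ ϖ : ℂˣ) : ℂ) 1 e e hz)
  filter_upwards [h1] with s hs j hj
  rw [if_pos (Int.ModEq.refl e), LFactor, if_neg (fun h => hχ (isUnramified_inv_iff.1 h)), LFactor, if_neg hχ,
    div_one, mul_one] at hs
  rw [theta, if_neg hχ]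
  have hj' := Finset.mem_range.1 hj
  by_cases hj0 : j = 0
  · rw [if_pos hj0, hs, hj0, Nat.cast_zero, zero_add, if_pos (Int.ModEq.refl e),
      ← mul_assoc,
      charNegOne_mul_self, one_mul]
  · rw [if_neg hj0, if_neg]
    intro h
    rw [Int.modEq_iff_dvd, add_sub_cancel_right, Int.natCast_dvd_natCast] at h
    exact absurd (Nat.le_of_dvd (Nat.pos_of_ne_zero hj0) h) (by omega)

/-- Far to the right `‖w * ‖ϖ‖^s‖ < min 1 ‖c‖`, which excludes equality there. This discards the
zeros of the denominators `1 - z`, `z - r` and `1 - z ^ n`. -/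
lemma eventually_codiscrete_mul_cpow_pow_ne (hϖ : IsUniformizer ϖ) (w : ℂ) {n : ℕ} (hn : 1 ≤ n)
    {c : ℂ} (hc : c ≠ 0) :
    ∀ᶠ s in codiscrete ℂ, (w * (‖(ϖ : F)‖ : ℂ) ^ s) ^ n ≠ c := by
  have hδ : 0 < min 1 ‖c‖ := lt_min one_pos (norm_pos_iff.2 hc)
  obtain ⟨a, ha⟩ := exists_forall_re_lt_norm_mul_cpow_lt hϖ w hδ
  have h := eventually_codiscrete_ne_zero
    (f := fun s => (w * (‖(ϖ : F)‖ : ℂ) ^ s) ^ n - c) (fun s _ =>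
      (((analyticAt_const.mul (analyticAt_norm_uniformizer_cpow ϖ s)).pow n).sub
        analyticAt_const).meromorphicAt) (isOpen_lt_re a)
    ⟨((a + 1 : ℝ) : ℂ), by rw [Set.mem_ofPred_eq, Complex.ofReal_re]; exact lt_add_one _⟩
    (fun s hs h0 => by
      have h1 := ha s hs
      have h2 : ‖(w * (‖(ϖ : F)‖ : ℂ) ^ s) ^ n‖ = ‖c‖ := by rw [sub_eq_zero.1 h0]
      rw [norm_pow] at h2
      have h3 := pow_le_of_le_one (norm_nonneg _)
        (h1.le.trans (min_le_left _ _)) (by omega : n ≠ 0)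
      have h4 := h1.trans_le (min_le_right _ _)
      linarith)
  filter_upwards [h] with s hs
  exact sub_ne_zero.1 hs

/-- For unramified `χ`, the generating series of the Gauss sums along residue classes are the
functions `θ_m`. -/
lemma isSeriesContinuation_theta_of_unramified (hϖ : IsUniformizer ϖ)
    (hnorm : ‖(ϖ : F)‖ = (residueCard F : ℝ)⁻¹) (hψc : Continuous ψ) (hψ : ψ ≠ 1)
    (hχ : IsUnramified χ) {n : ℕ} (hn : 1 ≤ n) :
    ∃ G : ℕ → ℂ → ℂ, (∀ j < n, IsSeriesContinuation ϖ ((χ ϖ : ℂˣ) : ℂ) n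
        (j + relConductor ϖ ψ χ) (gaussCoeff ϖ (selfDualMeasure ψ) χ ψ) (G j)) ∧
      ∀ᶠ s in codiscrete ℂ, ∀ j ∈ Finset.range n, G j s = theta ϖ n j s χ ψ := by
  have : (selfDualMeasure ψ).IsAddHaarMeasure := (isSelfDual_selfDualMeasure hϖ hnorm hψc hψ).1
  have he : relConductor ϖ ψ χ = addConductor ϖ ψ := by
    rw [relConductor, mulConductor_eq_zero hχ, Nat.cast_zero, sub_zero]
  rw [he]
  set e := addConductor ϖ ψ with he'
  set μ := selfDualMeasure ψ with hμ
  set w := ((χ ϖ : ℂˣ) : ℂ) with hw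
  have hw0 : w ≠ 0 := Units.ne_zero _
  set r : ℂ := (‖(ϖ : F)‖ : ℂ) with hr
  have hr0 : r ≠ 0 := by rw [hr]; exact_mod_cast (norm_pos_of_unit ϖ).ne'
  set V : ℂ := (μ.real (Metric.closedBall 0 1) : ℂ) with hV
  have hlow : ∀ m < e - 1, gaussCoeff ϖ μ χ ψ m = 0 := fun m hm =>
    gaussCoeff_eq_zero_of_lt χ hϖ hψc hψ μ le_rfl (fun u hu _ => hχ u hu)
      (by push_cast; omega)
  have hpred : gaussCoeff ϖ μ χ ψ (e - 1) = -r * V * w ^ (e - 1) :=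
    gaussCoeff_pred_of_unramified χ hϖ hnorm hψc hψ μ hχ
  have hhigh : ∀ m, e ≤ m → gaussCoeff ϖ μ χ ψ m = (1 - r) * V * w ^ m := fun m hm => by
    rw [gaussCoeff_of_le χ hϖ hnorm hψc hψ μ hm, mellinCoeff_one_zero_of_unramified χ hϖ hnorm μ hχ]
  -- Used with `d = 1` for `ε` and with `d = n` for `θ_j`. The exceptional exponent `e - 1` lies in
  -- the class of `j + e` exactly when `j = d - 1`.
  have hrat : ∀ (d j : ℕ), j < d → ∀ Q : ℂ, Q ≠ 0 →
      ratSeries d (j + e) (e - 1) e (gaussCoeff ϖ μ χ ψ) ((1 - r) * V) w Q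
        = (if j = d - 1 then -r * V * (w * Q) ^ (e - 1) else 0)
          + (1 - r) * V * ((w * Q) ^ (e + j) * (1 - (w * Q) ^ d)⁻¹) := by
    intro d j hj Q hQ
    have hIco : Finset.Ico (e - 1) e = {e - 1} := by
      ext m
      simp only [Finset.mem_Ico, Finset.mem_singleton]
      omega
    have hmod : ((j : ℤ) + e - e) % d = j := by
      rw [add_sub_cancel_right]
      exact Int.emod_eq_of_lt (by omega) (by omega)
    have hiff : e - 1 ≡ j + e [ZMOD d] ↔ j = d - 1 := by
      rw [Int.modEq_iff_dvd]
      have h1 : (j : ℤ) + e - (e - 1) = ((j + 1 : ℕ) : ℤ) := by push_cast; ring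
      rw [h1, Int.natCast_dvd_natCast]
      constructor
      · intro h
        have := Nat.le_of_dvd (Nat.succ_pos j) h
        omega
      · intro h
        have : j + 1 = d := by omega
        rw [this]
    rw [ratSeries, hIco, Finset.sum_singleton, hmod, hpred]
    congr 1
    by_cases hjd : j = d - 1
    · rw [if_pos hjd, if_pos (hiff.2 hjd), mul_zpow]
      ring
    · rw [if_neg hjd, if_neg (fun h => hjd (hiff.1 h))]
  refine ⟨_, fun j _ => isSeriesContinuation_ratSeries hn (j + e) hlow hhigh hw0, ?_⟩
  have h1 := epsilon_eventuallyEq hϖ hnorm hψc hψ (χ := χ)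
    (isSeriesContinuation_ratSeries (ϖ := ϖ) le_rfl ((0 : ℕ) + e) hlow hhigh hw0)
  filter_upwards [h1, eventually_codiscrete_mul_cpow_pow_ne hϖ w le_rfl one_ne_zero,
    eventually_codiscrete_mul_cpow_pow_ne hϖ w le_rfl hr0,
    eventually_codiscrete_mul_cpow_pow_ne hϖ w hn one_ne_zero] with s hs hs1 hs2 hs3 j hj
  have hj' := Finset.mem_range.1 hj
  have hQ0 : r ^ s ≠ 0 := norm_uniformizer_cpow_ne_zero ϖ s
  have hz0 : w * r ^ s ≠ 0 := mul_ne_zero hw0 hQ0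
  have hχ1 : ((χ (-1) : ℂˣ) : ℂ) = 1 := by
    rw [hχ (-1) (by simp), Units.val_one]
  have hq : (residueCard F : ℂ)⁻¹ = r := by rw [hr, hnorm]; simp
  rw [hrat 1 0 one_pos _ hQ0, if_pos rfl, hχ1, one_mul, LFactor_of_unramified hnorm hχ,
    LFactor_of_unramified hnorm hχ.inv, norm_uniformizer_cpow_one_sub, pow_one] at hs
  have hinv : (((χ⁻¹ : Fˣ →ₜ* ℂˣ) ϖ : ℂˣ) : ℂ) = w⁻¹ := Units.val_inv_eq_inv_val _
  rw [hinv, ← hr, ← hw] at hs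
  rw [hrat n j hj' _ hQ0, theta, if_pos hχ, hs, LFactor_of_unramified hnorm (hχ.pow n),
    LFactor_of_unramified hnorm (hχ.pow n).inv, norm_uniformizer_cpow_one_sub,
    residueCard_cpow_neg hnorm, hq]
  have hpow : (((χ ^ n : Fˣ →ₜ* ℂˣ) ϖ : ℂˣ) : ℂ) = w ^ n := by
    rw [ContinuousMonoidHom.pow_apply, Units.val_pow_eq_pow_val]
  have hpowinv : ((((χ ^ n)⁻¹ : Fˣ →ₜ* ℂˣ) ϖ : ℂˣ) : ℂ) = (w ^ n)⁻¹ := by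
    rw [← hpow]
    exact Units.val_inv_eq_inv_val _
  rw [hpow, hpowinv, Complex.cpow_nat_mul, ← hr, ← hw, ← mul_pow]
  have harr1 : w⁻¹ * (r * (r ^ s)⁻¹) = r * (w * r ^ s)⁻¹ := by rw [mul_inv]; ring
  have harr2 : (w ^ n)⁻¹ * (r * ((r ^ s) ^ n)⁻¹) = r * ((w * r ^ s) ^ n)⁻¹ := by
    rw [mul_pow, mul_inv]; ring
  rw [harr1, harr2]
  rw [pow_one] at hs1 hs2
  generalize w * r ^ s = z at hz0 hs1 hs2 hs3
  have h1z : 1 - z ≠ 0 := sub_ne_zero.2 hs1.symm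
  have hzr : z - r ≠ 0 := sub_ne_zero.2 hs2
  have h1zn : 1 - z ^ n ≠ 0 := sub_ne_zero.2 hs3.symm
  -- Since `-r * (1 - z) + (1 - r) * z = z - r`, the `L`-factors cancel everything but the monomial
  -- `ε⁻¹ = V * z ^ e`.
  have heps : (-r * V * z ^ (e - 1) + (1 - r) * V * (z ^ (e + (0 : ℕ)) * (1 - z)⁻¹))
      * (1 - r * z⁻¹)⁻¹ / (1 - z)⁻¹ = V * z ^ e := by
    have h2 : 1 - r * z⁻¹ = (z - r) * z⁻¹ := by field_simp
    have h3 : z ^ e = z ^ (e - 1) * z := by rw [← zpow_add_one₀ hz0, sub_add_cancel]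
    rw [h2, Nat.cast_zero, add_zero, h3]
    field_simp
    ring
  rw [heps, zpow_add₀ hz0, zpow_natCast]
  -- For `j = n - 1` the same identity with `z ^ n` in place of `z` merges the exceptional term with
  -- the geometric tail, giving `L(1 - ns, χ⁻ⁿ)⁻¹`; otherwise only the tail with its factor `1 - r`
  -- remains.
  by_cases hjn : j = n - 1
  · rw [if_pos hjn, if_pos hjn, inv_inv]
    have h3 : z ^ e * z ^ j = z ^ (e - 1) * z ^ n := by
      rw [← zpow_natCast, ← zpow_natCast, ← zpow_add₀ hz0, ← zpow_add₀ hz0]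
      congr 1
      omega
    have h4 : ∀ a b : ℂ, V * z ^ e * a * z ^ j * b = V * (z ^ e * z ^ j) * a * b :=
      fun a b => by ring
    have h5 : z ^ n ≠ 0 := pow_ne_zero n hz0
    rw [h4, h3]
    generalize z ^ n = y at h1zn h5
    field_simp
    ring
  · rw [if_neg hjn, if_neg hjn]
    ring

end FunctionalEquation

end LocalTate

open LocalTate in
theorem theorem3p1 {F : Type*} [NontriviallyNormedField F] [IsUltrametricDist F] [ProperSpace F]
    [MeasurableSpace F] [BorelSpace F]
    (ϖ : Fˣ) (hϖ : IsUniformizer ϖ) (hnorm : ‖(ϖ : F)‖ = (residueCard F : ℝ)⁻¹)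
    (n : ℕ) (hn : 1 ≤ n) (k : ℕ) (hk : k < n)
    (χ : Fˣ →ₜ* ℂˣ) (ψ : AddChar F Circle) (hψc : Continuous ψ) (hψ : ψ ≠ 1)
    (φ : F → ℂ) (hφ : IsSchwartzBruhat φ) :
    -- the partial Mellin transforms involved do have meromorphic continuations
    (∃ Z : ℂ → ℂ, IsMellinContinuation ψ χ (cutoff ϖ n k (fourier ψ φ)) Z) ∧
    (∀ j : ℤ, ∃ Z : ℂ → ℂ, IsMellinContinuation ψ χ⁻¹ (cutoff ϖ n j φ) Z) ∧
    -- the functional equation, as an identity of meromorphic functions of `s`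
    (fun s : ℂ => partialZeta ϖ ψ n k s χ (fourier ψ φ))
      =ᶠ[Filter.codiscrete ℂ] fun s : ℂ =>
        ∑ m ∈ Finset.range n, theta ϖ n m s χ ψ *
          partialZeta ϖ ψ n (m + relConductor ϖ ψ χ - k) (1 - s) χ⁻¹ φ := by
  have : (selfDualMeasure ψ).IsAddHaarMeasure := (isSelfDual_selfDualMeasure hϖ hnorm hψc hψ).1
  have hφ' : IsSchwartzBruhat (fourier ψ φ) := hφ.fourierWith hϖ hψc hψ _
  refine ⟨?_, fun j => ?_, ?_⟩
  · obtain ⟨R, hR⟩ := exists_isSeriesContinuation hϖ hnorm χ (selfDualMeasure ψ) hφ' hn k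
    exact ⟨_, isMellinContinuation_toMeromorphicNFOn hϖ hnorm hφ' hR⟩
  · obtain ⟨R, hR⟩ := exists_isSeriesContinuation hϖ hnorm χ⁻¹ (selfDualMeasure ψ) hφ hn j
    exact ⟨_, isMellinContinuation_toMeromorphicNFOn hϖ hnorm hφ hR⟩
  · obtain ⟨G, hG, hθ⟩ : ∃ G : ℕ → ℂ → ℂ, (∀ j < n, IsSeriesContinuation ϖ ((χ ϖ : ℂˣ) : ℂ) n
        (j + relConductor ϖ ψ χ) (gaussCoeff ϖ (selfDualMeasure ψ) χ ψ) (G j)) ∧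
        ∀ᶠ s in codiscrete ℂ, ∀ j ∈ Finset.range n, G j s = theta ϖ n j s χ ψ := by
      by_cases hχ : IsUnramified χ
      · exact isSeriesContinuation_theta_of_unramified hϖ hnorm hψc hψ hχ hn
      · exact isSeriesContinuation_theta_of_ramified hϖ hnorm hψc hψ hχ
    have hFE := zeta_fourier_eventuallyEq_sum hϖ hnorm hψc hψ hφ hn k _ hG
      fun s hs => summable_gaussCoeff hϖ hnorm hψc hψ _ hs
    filter_upwards [hFE, hθ] with s h1 h2
    rw [partialZeta, h1]
    exact Finset.sum_congr rfl fun j hj => by rw [h2 j hj, partialZeta]
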